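/- Let $x=(x_i)_{i\ge 1}$ and $b=(b_i)_{i\ge 1}$ be variables, $\beta$ a formal variable, and $u\oplus v:=u+v+\beta uv$. Let $\lambda=(\lambda_1\ge\cdots\ge\lambda_r>0)$ be a partition of length $r\ge 0$ with a flagging $f=(0<f_1\le\cdots\le f_r)$ (positive integers) such that $f_i\ge i$ for $1\le i\le r$. A flagged set-valued tableau $T$ of $(\lambda,f)$ assigns to each box of the Young diagram of $\lambda$ a nonempty set of positive integers, such that the sets in row $i$ are subsets of $\{1,\dots,f_i\}$, $\max A\le\min B$ if $B$ fills the box immediately to the right of the box filled by $A$, and $\max A<\min B$ if $B$ fills the box immediately below the box filled by $A$. Write $e\in T$ for an entry $e$, an element of the set in some box, counted once for each box that contains it; let $\mathrm{val}(e)$, $r(e)$, $c(e)$ be its value, row index and column index, and let $|T|$ be the number of entries. The factorial flagged Grothendieck polynomial is $$G_{\lambda,f}=\sum_{T}\beta^{|T|-|\lambda|}\prod_{e\in T}\bigl(x_{\mathrm{val}(e)}\oplus b_{\mathrm{val}(e)-r(e)+c(e)}\bigr)\in\mathbb Z[\beta][x,b],$$ the sum running over all flagged set-valued tableaux $T$ of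 $(\lambda,f)$, where $|\lambda|=\lambda_1+\cdots+\lambda_r$. For $i\ge 1$ let $$\pi_i(g)=\frac{(1+\beta x_{i+1})\,g-(1+\beta x_i)\,s_i(g)}{x_i-x_{i+1}},$$ where $s_i$ exchanges $x_i$ and $x_{i+1}$. Write $s_i$ also for the adjacent transposition $(i,\,i+1)$, and for a permutation $w$ with a reduced expression $w=s_{i_1}s_{i_2}\cdots s_{i_k}$ put $\pi_w=\pi_{i_k}\cdots\pi_{i_2}\pi_{i_1}$ (so $\pi_{i_1}$ is applied first). **Theorem 4.3.** Let $a_i=\lambda_i+f_i-i$ for $1\le i\le r$ and $$w=(s_rs_{r+1}\cdots s_{f_r-1})\cdots(s_2s_3\cdots s_{f_2-1})(s_1s_2\cdots s_{f_1-1}),$$ where the $i$-th factor is empty if $f_i=i$. Then the displayed expression of $w$ is reduced, and $$G_{\lambda,f}=\pi_w\Bigl(\prod_{i=1}^{r}\prod_{j=1}^{a_i}(x_i\oplus b_j)\Bigr),$$ where $\pi_w$ may be computed from any reduced expression of $w$. -/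

import Mathlib

/-- The coefficient ring `ℤ[β]`. -/
abbrev ZBeta : Type := Polynomial ℤ

/-- The ring `ℤ[β][x, b]`; `Sum.inl k` is the index of `x_k` and `Sum.inr k` that of `b_k`.
Indices run over `ℕ`, but only the variables with positive index occur in what follows. -/
abbrev PolyXB : Type := MvPolynomial (ℕ ⊕ ℕ) ZBeta

noncomputable section

/-- The formal variable `β`. -/
def betaVar : PolyXB := MvPolynomial.C Polynomial.X

/-- The variable `x_k`. -/
def varX (k : ℕ) : PolyXB := MvPolynomial.X (Sum.inl k)

/-- The variable `b_k`. -/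
def varB (k : ℕ) : PolyXB := MvPolynomial.X (Sum.inr k)

/-- `u ⊕ v = u + v + β u v`. -/
def oplus (u v : PolyXB) : PolyXB := u + v + betaVar * u * v

/-! ### Flagged partitions and set-valued tableaux -/

/-- `lam = (λ_1 ≥ ⋯ ≥ λ_r > 0)` is a partition of length `r` and `f = (0 < f_1 ≤ ⋯ ≤ f_r)` is a
flagging of it. The value at `i : Fin r` is the term with (one-based) index `i + 1`. -/
structure IsFlaggedPartition {r : ℕ} (lam f : Fin r → ℕ) : Prop where
  antitone : Antitone lam
  part_pos : ∀ i, 0 < lam i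
  monotone : Monotone f
  flag_pos : ∀ i, 0 < f i

/-- The boxes of the Young diagram of `lam`. -/
abbrev YBox {r : ℕ} (lam : Fin r → ℕ) : Type := (i : Fin r) × Fin (lam i)

/-- The one-based row index of a box. -/
def YBox.row {r : ℕ} {lam : Fin r → ℕ} (p : YBox lam) : ℕ := (p.1 : ℕ) + 1

/-- The one-based column index of a box. -/
def YBox.col {r : ℕ} {lam : Fin r → ℕ} (p : YBox lam) : ℕ := (p.2 : ℕ) + 1

/-- Set-valued tableaux of shape `lam`: nonempty finite sets of positive integers in the boxes,
weakly increasing along rows (`max A ≤ min B`) and strictly increasing down columns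
(`max A < min B`). -/
structure IsSetValuedTableau {r : ℕ} {lam : Fin r → ℕ} (T : YBox lam → Finset ℕ) : Prop where
  nonempty : ∀ p, (T p).Nonempty
  pos : ∀ p, ∀ e ∈ T p, 0 < e
  row_weak : ∀ p q : YBox lam, YBox.row q = YBox.row p → YBox.col q = YBox.col p + 1 →
    ∀ a ∈ T p, ∀ c ∈ T q, a ≤ c
  col_strict : ∀ p q : YBox lam, YBox.row q = YBox.row p + 1 → YBox.col q = YBox.col p →
    ∀ a ∈ T p, ∀ c ∈ T q, a < c

open Classical in
/-- The finite set of flagged set-valued tableaux of `(lam, f)`: the set-valued tableaux of shape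
`lam` whose boxes in row `i` are filled with subsets of `{1, …, f_i}`. -/
def flaggedTableaux {r : ℕ} (lam f : Fin r → ℕ) : Finset (YBox lam → Finset ℕ) :=
  (Fintype.piFinset fun p : YBox lam => (Finset.Icc 1 (f p.1)).powerset).filter
    fun T => IsSetValuedTableau T

theorem mem_flaggedTableaux {r : ℕ} {lam f : Fin r → ℕ} {T : YBox lam → Finset ℕ} :
    T ∈ flaggedTableaux lam f ↔
      IsSetValuedTableau T ∧ ∀ p : YBox lam, T p ⊆ Finset.Icc 1 (f p.1) := by
  simp [flaggedTableaux, and_comm]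

/-- `|λ|`, the number of boxes. -/
def partSize {r : ℕ} (lam : Fin r → ℕ) : ℕ := ∑ i, lam i

/-- `|T|`, the total number of entries. -/
def numEntries {r : ℕ} {lam : Fin r → ℕ} (T : YBox lam → Finset ℕ) : ℕ := ∑ p, (T p).card

/-- `[x|b]^T = ∏_{e ∈ T} (x_{val e} ⊕ b_{val e - r(e) + c(e)})`. In a set-valued tableau
`r(e) ≤ val e`, so the subtraction of natural numbers is the true one. -/
def tabWeight {r : ℕ} {lam : Fin r → ℕ} (T : YBox lam → Finset ℕ) : PolyXB :=
  ∏ p : YBox lam, ∏ e ∈ T p, oplus (varX e) (varB (e + YBox.col p - YBox.row p))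

/-- The factorial flagged Grothendieck polynomial `G_{λ,f}(x|b)`. The exponent `|T| - |λ|` is
non-negative, since the boxes hold nonempty sets. -/
def flaggedGrothendieck {r : ℕ} (lam f : Fin r → ℕ) : PolyXB :=
  ∑ T ∈ flaggedTableaux lam f, betaVar ^ (numEntries T - partSize lam) * tabWeight T

/-! ### Divided differences -/

/-- The ring automorphism `s_i` of `ℤ[β][x, b]` that exchanges `x_i` and `x_{i+1}`. -/
def swapX (i : ℕ) : PolyXB →ₐ[ZBeta] PolyXB :=
  MvPolynomial.rename (Sum.map (Equiv.swap i (i + 1)) id)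

/-- The numerator of `π_i(g)` is divisible by `x_i - x_{i+1}`. -/
theorem sub_dvd_numerator (i : ℕ) (g : PolyXB) :
    varX i - varX (i + 1) ∣ (1 + betaVar * varX (i + 1)) * g - (1 + betaVar * varX i) * swapX i g := by
  have key : varX i - varX (i + 1) ∣ g - swapX i g := by
    let I : Ideal PolyXB := Ideal.span {varX i - varX (i + 1)}
    have hx : Ideal.Quotient.mkₐ ZBeta I (varX i) = Ideal.Quotient.mkₐ ZBeta I (varX (i + 1)) :=
      Ideal.Quotient.eq.mpr (Ideal.subset_span rfl)
    have h : Ideal.Quotient.mkₐ ZBeta I = (Ideal.Quotient.mkₐ ZBeta I).comp (swapX i) := by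
      apply MvPolynomial.algHom_ext
      rintro (k | k)
      · rw [AlgHom.comp_apply, swapX, MvPolynomial.rename_X, Sum.map_inl]
        rcases eq_or_ne k i with rfl | h1
        · rw [Equiv.swap_apply_left]; exact hx
        · rcases eq_or_ne k (i + 1) with rfl | h2
          · rw [Equiv.swap_apply_right]; exact hx.symm
          · rw [Equiv.swap_apply_of_ne_of_ne h1 h2]
      · simp [swapX]
    exact Ideal.mem_span_singleton.mp (Ideal.Quotient.eq.mp (DFunLike.congr_fun h g))
  have e : (1 + betaVar * varX (i + 1)) * g - (1 + betaVar * varX i) * swapX i g =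
      (1 + betaVar * varX (i + 1)) * (g - swapX i g) -
        (varX i - varX (i + 1)) * (betaVar * swapX i g) := by ring
  rw [e]
  exact dvd_sub (key.mul_left _) (dvd_mul_right _ _)

/-- The `K`-theoretic divided difference operator
`π_i(g) = ((1 + β x_{i+1}) g - (1 + β x_i) s_i(g)) / (x_i - x_{i+1})`, the exact quotient in
`ℤ[β][x, b]`. -/
def dividedDiff (i : ℕ) (g : PolyXB) : PolyXB := (sub_dvd_numerator i g).choose

theorem dividedDiff_spec (i : ℕ) (g : PolyXB) :
    (varX i - varX (i + 1)) * dividedDiff i g =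
      (1 + betaVar * varX (i + 1)) * g - (1 + betaVar * varX i) * swapX i g :=
  (sub_dvd_numerator i g).choose_spec.symm

/-- The operator `π_{i_k} ⋯ π_{i_1}` attached to a word `(i_1, …, i_k)`; `π_{i_1}` acts first. -/
def dividedDiffWord (ω : List ℕ) (g : PolyXB) : PolyXB := ω.foldl (fun h i => dividedDiff i h) g

/-! ### Reduced expressions -/

/-- The product `s_{i_1} ⋯ s_{i_k}` of the adjacent transpositions `s_i = (i, i+1)`. -/
def wordProd (ω : List ℕ) : Equiv.Perm ℕ := (ω.map fun i => Equiv.swap i (i + 1)).prod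

/-- `w = s_{i_1} ⋯ s_{i_k}` with all `i_j ≥ 1`. -/
def IsExpression (ω : List ℕ) (w : Equiv.Perm ℕ) : Prop := (∀ i ∈ ω, 1 ≤ i) ∧ wordProd ω = w

/-- `w = s_{i_1} ⋯ s_{i_k}` is a reduced expression: one of minimal length. -/
def IsReducedExpression (ω : List ℕ) (w : Equiv.Perm ℕ) : Prop :=
  IsExpression ω w ∧ ∀ ω', IsExpression ω' w → ω.length ≤ ω'.length

/-- The word of `(s_r s_{r+1} ⋯ s_{f_r - 1}) ⋯ (s_2 s_3 ⋯ s_{f_2 - 1}) (s_1 s_2 ⋯ s_{f_1 - 1})`;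
the factor with `f_i = i` is empty. -/
def flagWord {r : ℕ} (f : Fin r → ℕ) : List ℕ :=
  (List.finRange r).reverse.flatMap fun i : Fin r => List.Ico ((i : ℕ) + 1) (f i)

end

/-!
Both sides are computed by the same recursion on the number of rows.

*Tableaux as chains of shapes.* Removing the largest value `v` from a set-valued tableau leaves a
tableau on the boxes that have an entry below `v`. If these form the shape `κ` inside `ν`, then the
entries `v` fill the horizontal strip `ν / κ` and, optionally, some corners of `κ` below which
there is no box of the strip. Hence the generating function of tableaux is a sum over chains of
shapes (`chainSum`, `entrySum_eq_chainSum`, `flaggedGrothendieck_eq_entrySum`) whose steps have the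
weight `transferWt`, a product over the rows; an optional corner entry of weight `u` contributes the
factor `1 + β u`.

*The operator `π_k`.* Let the first row have flag `k` and more boxes than the second row, and let
the other rows have flags larger than `k`. Then `π_k` removes a box from the first row and raises
its flag to `k + 1` (`dividedDiff_chainSum`). Only the two steps `μ ⊆ κ ⊆ ν` of the values `k` and
`k + 1` involve `x_k` and `x_{k+1}`. For given `μ` and `ν` the sum over `κ` decouples into a product
over the rows (`lowerSum_cons`). In one row it is a sum over the position at which the entries `k`
are replaced by `k + 1`, which telescopes (`sub_mul_splitSum`) and is a value of `π_k`, up to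
symmetric factors. Therefore the rows below the first contribute a polynomial symmetric in `x_k` and
`x_{k+1}`, apart from a factor tied to the row above (`rowSum_symm`, `swapX_edgeWt_mul_lowerSum`),
and in the first row `π_k` turns a run of entries `k` into the sum over all ways to fill one box
fewer with `k` and `k + 1` (`dividedDiff_stripWt_mul`).

*Induction on the rows.* If the flag of the first row is `1`, this row splits off as the product
`∏_{c ≤ λ_1} (x_1 ⊕ b_c)` (`chainSum_cons_first`), and it commutes with the operators of the other
rows, which involve only `π_2, π_3, …`. Starting from the length `λ_1 + f_1 - 1`, the operators
`π_1, …, π_{f_1 - 1}` raise the flag to `f_1` and lower the length to `λ_1`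
(`chainSum_eq_dividedDiffWord`). Rows and values are numbered from an offset `o` on, so that the
remaining rows are again an instance of the same statement.

*Reduced words.* The length of a reduced expression is the number of inversions
(`isReducedExpression_iff`), which grows with every letter of the displayed word
(`invCount_append_Ico`). The operators `π_i` satisfy the commutation and braid relations, and the
usual induction on the length shows that `π_w` is well defined (`dividedDiffWord_eq_of_reduced`).
-/

noncomputable section

/-! ### The operators `s_i` and `π_i` -/

theorem swapX_varX (i k : ℕ) : swapX i (varX k) = varX (Equiv.swap i (i + 1) k) := by
  simp [swapX, varX, MvPolynomial.rename_X]

@[simp] theorem swapX_varX_left (i : ℕ) : swapX i (varX i) = varX (i + 1) := by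
  simp [swapX_varX]

@[simp] theorem swapX_varX_right (i : ℕ) : swapX i (varX (i + 1)) = varX i := by
  simp [swapX_varX]

theorem swapX_varX_of_ne {i k : ℕ} (h1 : k ≠ i) (h2 : k ≠ i + 1) :
    swapX i (varX k) = varX k := by
  rw [swapX_varX, Equiv.swap_apply_of_ne_of_ne h1 h2]

@[simp] theorem swapX_varB (i k : ℕ) : swapX i (varB k) = varB k := by
  simp [swapX, varB, MvPolynomial.rename_X]

@[simp] theorem swapX_betaVar (i : ℕ) : swapX i betaVar = betaVar := by
  simp [swapX, betaVar]

theorem swapX_oplus (i : ℕ) (u v : PolyXB) :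
    swapX i (oplus u v) = oplus (swapX i u) (swapX i v) := by
  simp [oplus]

/-- Identities between products of adjacent transpositions carry over to the operators `s_i`. -/
theorem swapX_swapX (i j : ℕ) (g : PolyXB) :
    swapX i (swapX j g) = MvPolynomial.rename
      (Sum.map (Equiv.swap i (i + 1) * Equiv.swap j (j + 1) : Equiv.Perm ℕ) id) g := by
  rw [swapX, swapX, MvPolynomial.rename_rename, Sum.map_comp_map]
  rfl

@[simp] theorem swapX_involutive (i : ℕ) (g : PolyXB) : swapX i (swapX i g) = g := by
  rw [swapX_swapX, Equiv.swap_mul_self]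
  simp

theorem swap_comm_of_lt {i j : ℕ} (h : i + 1 < j) :
    (Equiv.swap i (i + 1) * Equiv.swap j (j + 1) : Equiv.Perm ℕ) =
      Equiv.swap j (j + 1) * Equiv.swap i (i + 1) := by
  apply Equiv.Perm.Disjoint.commute
  intro k
  by_cases h1 : k = i ∨ k = i + 1
  · exact Or.inr (Equiv.swap_apply_of_ne_of_ne (by omega) (by omega))
  · exact Or.inl (Equiv.swap_apply_of_ne_of_ne (by omega) (by omega))

theorem swap_braid (i : ℕ) :
    (Equiv.swap i (i + 1) * Equiv.swap (i + 1) (i + 2) * Equiv.swap i (i + 1) : Equiv.Perm ℕ) =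
      Equiv.swap (i + 1) (i + 2) * Equiv.swap i (i + 1) * Equiv.swap (i + 1) (i + 2) := by
  have h1 := Equiv.swap_mul_swap_mul_swap (show i + 2 ≠ i + 1 by omega) (show i + 2 ≠ i by omega)
  have h2 := Equiv.swap_mul_swap_mul_swap (show i ≠ i + 1 by omega) (show i ≠ i + 2 by omega)
  rw [h2, Equiv.swap_comm i (i + 1), Equiv.swap_comm (i + 1) (i + 2), h1, Equiv.swap_comm]

theorem swapX_comm_of_lt {i j : ℕ} (h : i + 1 < j) (g : PolyXB) :
    swapX i (swapX j g) = swapX j (swapX i g) := by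
  rw [swapX_swapX, swapX_swapX, swap_comm_of_lt h]

theorem swapX_braid (i : ℕ) (g : PolyXB) :
    swapX i (swapX (i + 1) (swapX i g)) = swapX (i + 1) (swapX i (swapX (i + 1) g)) := by
  rw [swapX_swapX, swapX_swapX, swapX, swapX, MvPolynomial.rename_rename,
    MvPolynomial.rename_rename, Sum.map_comp_map, Sum.map_comp_map]
  have h := congrArg (fun e : Equiv.Perm ℕ => (e : ℕ → ℕ)) (swap_braid i)
  simp only [Equiv.Perm.coe_mul] at h
  simp only [Equiv.Perm.coe_mul, Function.comp_id, h, add_assoc, Nat.reduceAdd]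

theorem varX_sub_varX_ne_zero {i j : ℕ} (h : i ≠ j) : varX i - varX j ≠ 0 := by
  rw [sub_ne_zero]
  intro e
  exact h (Sum.inl_injective (MvPolynomial.X_injective e))

theorem dividedDiff_unique {i : ℕ} {g h : PolyXB}
    (e : (varX i - varX (i + 1)) * h =
      (1 + betaVar * varX (i + 1)) * g - (1 + betaVar * varX i) * swapX i g) :
    dividedDiff i g = h :=
  mul_left_cancel₀ (varX_sub_varX_ne_zero (Nat.succ_ne_self i).symm)
    ((dividedDiff_spec i g).trans e.symm)

/-- `π_i(g)` is symmetric in `x_i` and `x_{i+1}`. -/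
theorem swapX_dividedDiff (i : ℕ) (g : PolyXB) :
    swapX i (dividedDiff i g) = dividedDiff i g := by
  symm
  apply dividedDiff_unique
  have h := congrArg (swapX i) (dividedDiff_spec i g)
  simp only [map_mul, map_sub, map_add, map_one, swapX_varX_left, swapX_varX_right,
    swapX_betaVar, swapX_involutive] at h
  linear_combination -h

/-- `π_i` is linear over the polynomials that are symmetric in `x_i` and `x_{i+1}`. -/
theorem dividedDiff_mul_of_symm {i : ℕ} {h : PolyXB} (hs : swapX i h = h) (g : PolyXB) :
    dividedDiff i (h * g) = h * dividedDiff i g := by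
  apply dividedDiff_unique
  rw [map_mul, hs]
  linear_combination h * dividedDiff_spec i g

theorem dividedDiff_add (i : ℕ) (g h : PolyXB) :
    dividedDiff i (g + h) = dividedDiff i g + dividedDiff i h := by
  apply dividedDiff_unique
  rw [map_add]
  linear_combination dividedDiff_spec i g + dividedDiff_spec i h

theorem dividedDiff_zero (i : ℕ) : dividedDiff i 0 = 0 := by
  apply dividedDiff_unique
  simp

theorem dividedDiff_sum {ι : Type*} (i : ℕ) (s : Finset ι) (g : ι → PolyXB) :
    dividedDiff i (∑ a ∈ s, g a) = ∑ a ∈ s, dividedDiff i (g a) :=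
  map_sum (AddMonoidHom.mk' (dividedDiff i) (dividedDiff_add i)) g s

theorem dividedDiff_comm_of_lt {i j : ℕ} (h : i + 1 < j) (g : PolyXB) :
    dividedDiff i (dividedDiff j g) = dividedDiff j (dividedDiff i g) := by
  apply dividedDiff_unique
  apply mul_left_cancel₀ (varX_sub_varX_ne_zero (Nat.succ_ne_self j).symm)
  have h1 := congrArg (swapX i) (dividedDiff_spec j g)
  have h2 := congrArg (swapX j) (dividedDiff_spec i g)
  have e1 : swapX i (varX j) = varX j := swapX_varX_of_ne (by omega) (by omega)
  have e2 : swapX i (varX (j + 1)) = varX (j + 1) := swapX_varX_of_ne (by omega) (by omega)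
  have e3 : swapX j (varX i) = varX i := swapX_varX_of_ne (by omega) (by omega)
  have e4 : swapX j (varX (i + 1)) = varX (i + 1) := swapX_varX_of_ne (by omega) (by omega)
  simp only [map_mul, map_sub, map_add, map_one, swapX_betaVar, e1, e2, e3, e4] at h1 h2
  have h3 := dividedDiff_spec i g
  have h4 := dividedDiff_spec j g
  have h5 := dividedDiff_spec j (dividedDiff i g)
  rw [swapX_comm_of_lt h] at h1
  linear_combination (varX i - varX (i + 1)) * h5 + (1 + betaVar * varX (j + 1)) * h3
    - (1 + betaVar * varX j) * h2 - (1 + betaVar * varX (i + 1)) * h4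
    + (1 + betaVar * varX i) * h1

theorem dividedDiff_braid (i : ℕ) (g : PolyXB) :
    dividedDiff i (dividedDiff (i + 1) (dividedDiff i g)) =
      dividedDiff (i + 1) (dividedDiff i (dividedDiff (i + 1) g)) := by
  have e1 : swapX i (varX (i + 2)) = varX (i + 2) := swapX_varX_of_ne (by omega) (by omega)
  have e2 : swapX (i + 1) (varX i) = varX i := swapX_varX_of_ne (by omega) (by omega)
  have e3 : swapX (i + 1) (varX (i + 2)) = varX (i + 1) := swapX_varX_right (i + 1)
  have e4 : swapX (i + 1) (varX (i + 1)) = varX (i + 2) := swapX_varX_left (i + 1)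
  have hab := varX_sub_varX_ne_zero (show i ≠ i + 1 by omega)
  have hac := varX_sub_varX_ne_zero (show i ≠ i + 2 by omega)
  have hbc := varX_sub_varX_ne_zero (show i + 1 ≠ i + 2 by omega)
  apply mul_left_cancel₀ (mul_ne_zero (mul_ne_zero hab hac) hbc)
  -- the left-hand side, expanded in the six images of `g` under permutations of the variables
  have p1 := dividedDiff_spec i g
  have p2 := congrArg (swapX (i + 1)) p1
  have p3 := congrArg (swapX i) p2
  have p4 := dividedDiff_spec (i + 1) (dividedDiff i g)
  have p5 := congrArg (swapX i) p4
  have p6 := dividedDiff_spec i (dividedDiff (i + 1) (dividedDiff i g))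
  -- the same for the right-hand side
  have q1 := dividedDiff_spec (i + 1) g
  have q2 := congrArg (swapX i) q1
  have q3 := congrArg (swapX (i + 1)) q2
  have q4 := dividedDiff_spec i (dividedDiff (i + 1) g)
  have q5 := congrArg (swapX (i + 1)) q4
  have q6 := dividedDiff_spec (i + 1) (dividedDiff i (dividedDiff (i + 1) g))
  simp only [map_mul, map_sub, map_add, map_one, swapX_betaVar, swapX_varX_left,
    swapX_varX_right, swapX_dividedDiff, e1, e2, e3, e4, add_assoc, Nat.reduceAdd]
    at p1 p2 p3 p4 p5 p6 q1 q2 q3 q4 q5 q6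
  rw [swapX_braid] at p3
  generalize varX i = a at *
  generalize varX (i + 1) = b at *
  generalize varX (i + 2) = c at *
  generalize betaVar = β at *
  linear_combination (a - c) * (b - c) * p6 + (1 + β * b) * (a - c) * p4
    - (1 + β * a) * (b - c) * p5 + (1 + β * c) ^ 2 * p1 - (1 + β * b) ^ 2 * p2
    + (1 + β * a) ^ 2 * p3
    - ((a - c) * (a - b) * q6 + (1 + β * c) * (a - c) * q4
    - (1 + β * b) * (a - b) * q5 + (1 + β * b) * (1 + β * c) * q1
    - (1 + β * c) * (1 + β * a) * q2 + (1 + β * b) * (1 + β * a) * q3)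

theorem dividedDiffWord_append (p q : List ℕ) (g : PolyXB) :
    dividedDiffWord (p ++ q) g = dividedDiffWord q (dividedDiffWord p g) := by
  simp [dividedDiffWord]

/-! ### Reduced words -/

/-- The inversions of a permutation of `ℕ`. -/
def inversions (w : Equiv.Perm ℕ) : Set (ℕ × ℕ) := {p | p.1 < p.2 ∧ w p.2 < w p.1}

/-- An ascent at `i`: right multiplication by `s_i` creates the inversion `(i, i + 1)` and
transports the others. -/
theorem inversions_mul_swap {w : Equiv.Perm ℕ} {i : ℕ} (h : w i < w (i + 1)) :
    inversions (w * Equiv.swap i (i + 1)) = insert (i, i + 1)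
      ((Equiv.prodCongr (Equiv.swap i (i + 1)) (Equiv.swap i (i + 1))) '' inversions w) := by
  ext ⟨a, b⟩
  rw [Equiv.image_eq_preimage_symm]
  simp only [inversions, Set.mem_ofPred_eq, Equiv.Perm.mul_apply, Set.mem_insert_iff,
    Prod.mk.injEq, Set.mem_preimage, Equiv.prodCongr_symm, Equiv.symm_swap,
    Equiv.prodCongr_apply, Prod.map_apply]
  by_cases ha : a = i
  · subst ha
    by_cases hb : b = a + 1
    · subst hb
      simp [h]
    · by_cases hb' : b = a
      · simp [hb']
      · rw [Equiv.swap_apply_left, Equiv.swap_apply_of_ne_of_ne hb' hb]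
        have : a < b ↔ a + 1 < b := by omega
        simp [this, hb]
  · by_cases ha' : a = i + 1
    · subst ha'
      by_cases hb : b = i
      · subst hb
        simp only [Equiv.swap_apply_left, Equiv.swap_apply_right]
        omega
      · by_cases hb' : b = i + 1
        · simp [hb']
        · rw [Equiv.swap_apply_right, Equiv.swap_apply_of_ne_of_ne hb hb']
          have : i + 1 < b ↔ i < b := by omega
          simp [this]
    · rw [Equiv.swap_apply_of_ne_of_ne ha ha']
      by_cases hb : b = i
      · subst hb
        rw [Equiv.swap_apply_left]
        have : a < b ↔ a < b + 1 := by omega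
        simp [this, ha]
      · by_cases hb' : b = i + 1
        · subst hb'
          rw [Equiv.swap_apply_right]
          have : a < i + 1 ↔ a < i := by omega
          simp [this, ha]
        · rw [Equiv.swap_apply_of_ne_of_ne hb hb']
          simp [ha]

/-- The number of inversions, with the junk value `0` for permutations with infinitely many. -/
def invCount (w : Equiv.Perm ℕ) : ℕ := (inversions w).ncard

theorem finite_inversions_mul_swap {w : Equiv.Perm ℕ} {i : ℕ} (h : w i < w (i + 1))
    (hw : (inversions w).Finite) : (inversions (w * Equiv.swap i (i + 1))).Finite := by
  rw [inversions_mul_swap h]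
  exact (hw.image _).insert _

theorem invCount_mul_swap_of_ascent {w : Equiv.Perm ℕ} {i : ℕ} (h : w i < w (i + 1))
    (hw : (inversions w).Finite) :
    invCount (w * Equiv.swap i (i + 1)) = invCount w + 1 := by
  rw [invCount, inversions_mul_swap h, Set.ncard_insert_of_notMem _ (hw.image _),
    Set.ncard_image_of_injective _ (Equiv.injective _), invCount]
  rintro ⟨⟨a, b⟩, hab, e⟩
  simp only [Equiv.prodCongr_apply, Prod.map_apply, Prod.mk.injEq] at e
  have ha : a = i + 1 := by
    rw [← Equiv.swap_apply_left i (i + 1)]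
    exact (Equiv.swap_apply_eq_iff).1 e.1
  have hb : b = i := by
    rw [← Equiv.swap_apply_right i (i + 1)]
    exact (Equiv.swap_apply_eq_iff).1 e.2
  have := hab.1
  simp only at this
  omega

theorem ascent_mul_swap {w : Equiv.Perm ℕ} {i : ℕ} (h : w (i + 1) < w i) :
    (w * Equiv.swap i (i + 1)) i < (w * Equiv.swap i (i + 1)) (i + 1) := by
  simpa using h

theorem mul_swap_mul_swap_self (w : Equiv.Perm ℕ) (i : ℕ) :
    w * Equiv.swap i (i + 1) * Equiv.swap i (i + 1) = w := by
  rw [mul_assoc, Equiv.swap_mul_self, mul_one]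

/-- Right multiplication by `s_i` preserves the finiteness of the set of inversions. -/
theorem finite_inversions_mul_swap' {w : Equiv.Perm ℕ} (i : ℕ)
    (hw : (inversions w).Finite) : (inversions (w * Equiv.swap i (i + 1))).Finite := by
  rcases lt_or_gt_of_ne (w.injective.ne (Nat.succ_ne_self i).symm) with h | h
  · exact finite_inversions_mul_swap h hw
  · have e := inversions_mul_swap (ascent_mul_swap h)
    rw [mul_swap_mul_swap_self] at e
    refine Set.Finite.of_finite_image (hw.subset ?_) (Equiv.injective (Equiv.prodCongr
      (Equiv.swap i (i + 1)) (Equiv.swap i (i + 1)))).injOn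
    rw [e]
    exact Set.subset_insert _ _

theorem invCount_of_descent {w : Equiv.Perm ℕ} {i : ℕ} (h : w (i + 1) < w i)
    (hw : (inversions w).Finite) :
    invCount w = invCount (w * Equiv.swap i (i + 1)) + 1 := by
  have e := invCount_mul_swap_of_ascent (ascent_mul_swap h) (finite_inversions_mul_swap' i hw)
  rwa [mul_swap_mul_swap_self] at e

theorem invCount_mul_swap_le {w : Equiv.Perm ℕ} (i : ℕ) (hw : (inversions w).Finite) :
    invCount (w * Equiv.swap i (i + 1)) ≤ invCount w + 1 := by
  rcases lt_or_gt_of_ne (w.injective.ne (Nat.succ_ne_self i).symm) with h | h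
  · exact (invCount_mul_swap_of_ascent h hw).le
  · have := invCount_of_descent h hw
    omega

theorem inversions_one : inversions 1 = ∅ := by
  ext p
  simp only [inversions, Equiv.Perm.coe_one, id, Set.mem_ofPred_eq, Set.mem_empty_iff_false,
    iff_false]
  omega

theorem invCount_one : invCount 1 = 0 := by
  rw [invCount, inversions_one, Set.ncard_empty]

@[simp] theorem wordProd_nil : wordProd [] = 1 := rfl

theorem wordProd_concat (p : List ℕ) (i : ℕ) :
    wordProd (p ++ [i]) = wordProd p * Equiv.swap i (i + 1) := by
  simp [wordProd]

theorem finite_inversions_wordProd (ω : List ℕ) : (inversions (wordProd ω)).Finite := by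
  induction ω using List.reverseRecOn with
  | nil => rw [wordProd_nil, inversions_one]; exact Set.finite_empty
  | append_singleton p i ih => rw [wordProd_concat]; exact finite_inversions_mul_swap' i ih

theorem invCount_wordProd_le (ω : List ℕ) : invCount (wordProd ω) ≤ ω.length := by
  induction ω using List.reverseRecOn with
  | nil => rw [wordProd_nil, invCount_one]; exact Nat.zero_le _
  | append_singleton p i ih =>
    rw [wordProd_concat, List.length_append, List.length_singleton]
    exact (invCount_mul_swap_le i (finite_inversions_wordProd p)).trans (by omega)

theorem wordProd_apply_zero {ω : List ℕ} (h : ∀ i ∈ ω, 1 ≤ i) : wordProd ω 0 = 0 := by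
  induction ω using List.reverseRecOn with
  | nil => rfl
  | append_singleton p i ih =>
    have hi : 1 ≤ i := h i (by simp)
    rw [wordProd_concat, Equiv.Perm.mul_apply,
      Equiv.swap_apply_of_ne_of_ne (by omega) (by omega)]
    exact ih fun j hj => h j (by simp [hj])

/-- A permutation of `ℕ` without descents is the identity. -/
theorem eq_one_of_no_descent {w : Equiv.Perm ℕ} (h : ∀ i, w i < w (i + 1)) : w = 1 := by
  have hm : StrictMono w := strictMono_nat_of_lt_succ h
  have e : w.toOrderIso hm.monotone (fun a b hab => by
      by_contra hlt
      have := hm (not_le.1 hlt)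
      simp only [Equiv.apply_symm_apply] at this
      omega) = OrderIso.refl ℕ := Subsingleton.elim _ _
  ext n
  exact congrArg (fun e : ℕ ≃o ℕ => e n) e

/-- A permutation with finitely many inversions that fixes `0` has an expression whose length is
the number of its inversions. -/
theorem exists_expression {w : Equiv.Perm ℕ} (hw : (inversions w).Finite) (h0 : w 0 = 0) :
    ∃ ω, IsExpression ω w ∧ ω.length = invCount w := by
  induction hn : invCount w generalizing w with
  | zero =>
    refine ⟨[], ⟨by simp, ?_⟩, rfl⟩
    rw [wordProd_nil]
    refine (eq_one_of_no_descent fun i => ?_).symm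
    by_contra hi
    have hi' := lt_of_le_of_ne (not_lt.1 hi) (w.injective.ne (Nat.succ_ne_self i))
    have := invCount_of_descent hi' hw
    omega
  | succ n ih =>
    have hd : ∃ i, w (i + 1) < w i := by
      by_contra! hall
      have := eq_one_of_no_descent fun i =>
        lt_of_le_of_ne (hall i) (w.injective.ne (Nat.succ_ne_self i).symm)
      rw [this, invCount_one] at hn
      omega
    obtain ⟨i, hi⟩ := hd
    have hi1 : 1 ≤ i := by
      by_contra! hlt
      obtain rfl : i = 0 := by omega
      omega
    obtain ⟨ω, hω, hl⟩ := ih (finite_inversions_mul_swap' i hw)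
      (by rw [Equiv.Perm.mul_apply, Equiv.swap_apply_of_ne_of_ne (by omega) (by omega), h0])
      (by have := invCount_of_descent hi hw; omega)
    refine ⟨ω ++ [i], ⟨?_, ?_⟩, by simp [hl]⟩
    · intro j hj
      rcases List.mem_append.1 hj with hj | hj
      · exact hω.1 j hj
      · rwa [List.mem_singleton.1 hj]
    · rw [wordProd_concat, hω.2, mul_swap_mul_swap_self]

theorem isReducedExpression_iff {ω : List ℕ} {w : Equiv.Perm ℕ} :
    IsReducedExpression ω w ↔ IsExpression ω w ∧ ω.length = invCount w := by
  constructor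
  · rintro ⟨hω, hmin⟩
    refine ⟨hω, le_antisymm ?_ (hω.2 ▸ invCount_wordProd_le ω)⟩
    obtain ⟨ω', hω', hl⟩ := exists_expression (hω.2 ▸ finite_inversions_wordProd ω)
      (hω.2 ▸ wordProd_apply_zero hω.1)
    exact hl ▸ hmin ω' hω'
  · rintro ⟨hω, hl⟩
    refine ⟨hω, fun ω' hω' => ?_⟩
    rw [hl, ← hω'.2]
    exact invCount_wordProd_le ω'

theorem IsReducedExpression.of_concat {p : List ℕ} {i : ℕ} {w : Equiv.Perm ℕ}
    (h : IsReducedExpression (p ++ [i]) w) :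
    w (i + 1) < w i ∧ 1 ≤ i ∧ IsReducedExpression p (w * Equiv.swap i (i + 1)) := by
  rw [isReducedExpression_iff] at h
  obtain ⟨⟨hpos, rfl⟩, hl⟩ := h
  have hp := invCount_wordProd_le p
  rw [wordProd_concat] at *
  rw [List.length_append, List.length_singleton] at hl
  have hd : wordProd p i < wordProd p (i + 1) := by
    by_contra hi
    have hi' := lt_of_le_of_ne (not_lt.1 hi) ((wordProd p).injective.ne (Nat.succ_ne_self i))
    have := invCount_of_descent hi' (finite_inversions_wordProd p)
    omega
  refine ⟨by simpa using hd, hpos i (by simp), ?_⟩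
  rw [isReducedExpression_iff, mul_swap_mul_swap_self]
  refine ⟨⟨fun j hj => hpos j (by simp [hj]), rfl⟩, ?_⟩
  have := invCount_mul_swap_of_ascent hd (finite_inversions_wordProd p)
  omega

theorem IsReducedExpression.concat {p : List ℕ} {i : ℕ} {w : Equiv.Perm ℕ} (hi : 1 ≤ i)
    (hp : IsReducedExpression p (w * Equiv.swap i (i + 1))) (hd : w (i + 1) < w i) :
    IsReducedExpression (p ++ [i]) w := by
  rw [isReducedExpression_iff] at *
  have hw : (inversions w).Finite := by
    rw [← mul_swap_mul_swap_self w i, ← hp.1.2]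
    exact finite_inversions_mul_swap' i (finite_inversions_wordProd p)
  refine ⟨⟨?_, ?_⟩, ?_⟩
  · intro j hj
    rcases List.mem_append.1 hj with hj | hj
    · exact hp.1.1 j hj
    · rwa [List.mem_singleton.1 hj]
  · rw [wordProd_concat, hp.1.2, mul_swap_mul_swap_self]
  · rw [List.length_append, List.length_singleton, hp.2, invCount_of_descent hd hw]

theorem exists_reducedExpression {p : List ℕ} {w : Equiv.Perm ℕ} (hp : IsExpression p w) :
    ∃ q, IsReducedExpression q w := by
  obtain ⟨q, hq, hl⟩ := exists_expression (hp.2 ▸ finite_inversions_wordProd p)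
    (hp.2 ▸ wordProd_apply_zero hp.1)
  exact ⟨q, isReducedExpression_iff.2 ⟨hq, hl⟩⟩

theorem IsExpression.concat {p : List ℕ} {i : ℕ} {w : Equiv.Perm ℕ} (hp : IsExpression p w)
    (hi : 1 ≤ i) : IsExpression (p ++ [i]) (w * Equiv.swap i (i + 1)) := by
  refine ⟨fun j hj => ?_, by rw [wordProd_concat, hp.2]⟩
  rcases List.mem_append.1 hj with hj | hj
  · exact hp.1 j hj
  · rwa [List.mem_singleton.1 hj]

/-- Two descents `i < j` of `w`: there are reduced expressions of `w` that end in `i` and in `j`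
and have the same operator. -/
theorem exists_reduced_pair {w : Equiv.Perm ℕ} {i j : ℕ} (hi : 1 ≤ i) (hij : i < j)
    (hdi : w (i + 1) < w i) (hdj : w (j + 1) < w j) (hw : ∃ p, IsExpression p w) :
    ∃ p q, IsReducedExpression (p ++ [i]) w ∧ IsReducedExpression (q ++ [j]) w ∧
      ∀ g, dividedDiffWord (p ++ [i]) g = dividedDiffWord (q ++ [j]) g := by
  obtain ⟨p₀, hp₀⟩ := hw
  have hj : 1 ≤ j := by omega
  rcases (show i + 1 < j ∨ j = i + 1 by omega) with h | rfl
  · obtain ⟨u, hu⟩ := exists_reducedExpression ((hp₀.concat hi).concat hj)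
    have hu' : IsReducedExpression u
        (w * Equiv.swap j (j + 1) * Equiv.swap i (i + 1)) := by
      rwa [mul_assoc, ← swap_comm_of_lt h, ← mul_assoc]
    refine ⟨u ++ [j], u ++ [i], (hu.concat hj ?_).concat hi hdi,
      (hu'.concat hi ?_).concat hj hdj, fun g => ?_⟩
    · rwa [Equiv.Perm.mul_apply, Equiv.Perm.mul_apply,
        Equiv.swap_apply_of_ne_of_ne (by omega) (by omega),
        Equiv.swap_apply_of_ne_of_ne (by omega) (by omega)]
    · rwa [Equiv.Perm.mul_apply, Equiv.Perm.mul_apply,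
        Equiv.swap_apply_of_ne_of_ne (by omega) (by omega),
        Equiv.swap_apply_of_ne_of_ne (by omega) (by omega)]
    · simp only [dividedDiffWord_append]
      exact dividedDiff_comm_of_lt h _
  · obtain ⟨u, hu⟩ := exists_reducedExpression (((hp₀.concat hi).concat hj).concat hi)
    have hu' : IsReducedExpression u (w * Equiv.swap (i + 1) (i + 2) * Equiv.swap i (i + 1) *
        Equiv.swap (i + 1) (i + 2)) := by
      have e := swap_braid i
      rw [mul_assoc, mul_assoc] at e ⊢
      rw [← e, ← mul_assoc, ← mul_assoc]
      exact hu
    have e1 : Equiv.swap i (i + 1) (i + 2) = i + 2 :=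
      Equiv.swap_apply_of_ne_of_ne (by omega) (by omega)
    have e2 : Equiv.swap (i + 1) (i + 2) i = i :=
      Equiv.swap_apply_of_ne_of_ne (by omega) (by omega)
    have e3 : Equiv.swap i (i + 1) i = i + 1 := Equiv.swap_apply_left _ _
    have e4 : Equiv.swap i (i + 1) (i + 1) = i := Equiv.swap_apply_right _ _
    have e5 : Equiv.swap (i + 1) (i + 2) (i + 1) = i + 2 := Equiv.swap_apply_left _ _
    have e6 : Equiv.swap (i + 1) (i + 2) (i + 2) = i + 1 := Equiv.swap_apply_right _ _
    have hdj' : w (i + 2) < w (i + 1) := hdj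
    refine ⟨u ++ [i] ++ [i + 1], u ++ [i + 1] ++ [i],
      ((hu.concat hi ?_).concat hj ?_).concat hi hdi,
      ((hu'.concat hj ?_).concat hi ?_).concat hj hdj, fun g => ?_⟩
    · simpa only [Equiv.Perm.mul_apply, e1, e2, e3, e4, e5, e6, add_assoc, Nat.reduceAdd]
        using hdj'
    · simp only [Equiv.Perm.mul_apply, e1, e4, add_assoc, Nat.reduceAdd]
      omega
    · simpa only [Equiv.Perm.mul_apply, e1, e2, e3, e4, e5, e6, add_assoc, Nat.reduceAdd]
        using hdi
    · simp only [Equiv.Perm.mul_apply, e2, e5]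
      omega
    · simp only [dividedDiffWord_append]
      exact dividedDiff_braid i _

/-- The word property: the operator `π_w` does not depend on the reduced expression of `w`. -/
theorem dividedDiffWord_eq_of_reduced {w : Equiv.Perm ℕ} {ω ω' : List ℕ}
    (h : IsReducedExpression ω w) (h' : IsReducedExpression ω' w) (g : PolyXB) :
    dividedDiffWord ω g = dividedDiffWord ω' g := by
  induction hn : ω.length generalizing w ω ω' g with
  | zero =>
    have hl := (isReducedExpression_iff.1 h).2.trans (isReducedExpression_iff.1 h').2.symm
    rw [List.length_eq_zero_iff.1 hn, List.length_eq_zero_iff.1 (hl.symm.trans hn)]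
  | succ n ih =>
    have hl := (isReducedExpression_iff.1 h).2.trans (isReducedExpression_iff.1 h').2.symm
    have last : ∀ {p q : List ℕ} {i : ℕ}, (p ++ [i]).length = n + 1 →
        IsReducedExpression (p ++ [i]) w → IsReducedExpression (q ++ [i]) w →
        ∀ g, dividedDiffWord (p ++ [i]) g = dividedDiffWord (q ++ [i]) g := by
      intro p q i hlen hp hq g
      rw [dividedDiffWord_append, dividedDiffWord_append,
        ih hp.of_concat.2.2 hq.of_concat.2.2 g (by simpa using hlen)]
    have len : ∀ {u : List ℕ}, IsReducedExpression u w → u.length = n + 1 := fun hu =>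
      (isReducedExpression_iff.1 hu).2.trans ((isReducedExpression_iff.1 h).2.symm.trans hn)
    obtain rfl | ⟨p, i, rfl⟩ := List.eq_nil_or_concat' ω
    · simp at hn
    obtain rfl | ⟨p', j, rfl⟩ := List.eq_nil_or_concat' ω'
    · simp at hl
    have key : ∀ {i j : ℕ} {p p' : List ℕ}, i < j → IsReducedExpression (p ++ [i]) w →
        IsReducedExpression (p' ++ [j]) w →
        dividedDiffWord (p ++ [i]) g = dividedDiffWord (p' ++ [j]) g := by
      intro i j p p' hij hp hp'
      obtain ⟨u, v, hu, hv, e⟩ := exists_reduced_pair hp.of_concat.2.1 hij hp.of_concat.1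
        hp'.of_concat.1 ⟨_, hp.1⟩
      rw [last (len hp) hp hu, e, last (len hv) hv hp']
    rcases lt_trichotomy i j with hij | rfl | hij
    · exact key hij h h'
    · exact last hn h h' g
    · exact (key hij h' h).symm

/-- The word of `flagWord` with the rows numbered from `o + 1` on: the block of the `i`-th entry
of `f` (from `0`) is `s_{o + i + 1} ⋯ s_{f_i - 1}`. -/
def flagBlocks (o : ℕ) {r : ℕ} (f : Fin r → ℕ) : List ℕ :=
  (List.finRange r).reverse.flatMap fun i : Fin r => List.Ico (o + (i : ℕ) + 1) (f i)

theorem flagBlocks_zero {r : ℕ} (f : Fin r → ℕ) : flagBlocks 0 f = flagWord f := by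
  simp [flagBlocks, flagWord]

theorem flagBlocks_cons (o : ℕ) {r : ℕ} (k : ℕ) (f : Fin r → ℕ) :
    flagBlocks o (Fin.cons k f : Fin (r + 1) → ℕ) =
      flagBlocks (o + 1) f ++ List.Ico (o + 1) k := by
  have e : ∀ i : ℕ, o + (i + 1) + 1 = o + 1 + i + 1 := by omega
  simp [flagBlocks, List.finRange_succ, List.flatMap_append, List.flatMap_map,
    ← List.map_reverse, e]

theorem le_of_mem_flagBlocks {o r i : ℕ} {f : Fin r → ℕ} (h : i ∈ flagBlocks o f) :
    o + 1 ≤ i := by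
  simp only [flagBlocks, List.mem_flatMap, List.Ico.mem] at h
  obtain ⟨_, _, h, _⟩ := h
  omega

theorem wordProd_apply_of_le {o : ℕ} {ω : List ℕ} (h : ∀ i ∈ ω, o + 1 ≤ i) {n : ℕ}
    (hn : n ≤ o) : wordProd ω n = n := by
  induction ω using List.reverseRecOn with
  | nil => rfl
  | append_singleton p i ih =>
    have hi : o + 1 ≤ i := h i (by simp)
    rw [wordProd_concat, Equiv.Perm.mul_apply,
      Equiv.swap_apply_of_ne_of_ne (by omega) (by omega)]
    exact ih fun j hj => h j (by simp [hj])

/-- Appending a block `s_j s_{j+1} ⋯` to a word in later letters keeps it reduced: the value `j`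
travels to the right past larger values, so every letter is an ascent. -/
theorem invCount_append_Ico {p : List ℕ} {j : ℕ} (hp : ∀ i ∈ p, j + 1 ≤ i)
    (hl : invCount (wordProd p) = p.length) (d : ℕ) :
    wordProd (p ++ List.Ico j (j + d)) (j + d) = j ∧
    (∀ n, j + d < n → wordProd (p ++ List.Ico j (j + d)) n = wordProd p n) ∧
    invCount (wordProd (p ++ List.Ico j (j + d))) = p.length + d := by
  induction d with
  | zero => simpa [hl] using wordProd_apply_of_le hp le_rfl
  | succ d ih =>
    obtain ⟨h1, h2, h3⟩ := ih
    rw [← add_assoc, List.Ico.succ_top (by omega), ← List.append_assoc, wordProd_concat]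
    refine ⟨by simp [h1], fun n hn => ?_, ?_⟩
    · rw [Equiv.Perm.mul_apply, Equiv.swap_apply_of_ne_of_ne (by omega) (by omega)]
      exact h2 n (by omega)
    · rw [invCount_mul_swap_of_ascent _ (finite_inversions_wordProd _), h3, add_assoc]
      rw [h1, h2 _ (by omega)]
      by_contra hle
      have e := wordProd_apply_of_le hp (not_lt.1 hle)
      have := (wordProd p).injective e
      omega

theorem invCount_flagBlocks (o : ℕ) {r : ℕ} (f : Fin r → ℕ) :
    invCount (wordProd (flagBlocks o f)) = (flagBlocks o f).length := by
  induction r generalizing o with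
  | zero => simp [flagBlocks, invCount_one]
  | succ r ih =>
    obtain ⟨k, f, rfl⟩ : ∃ k f', f = Fin.cons k f' := ⟨f 0, Fin.tail f, (Fin.cons_self_tail f).symm⟩
    rw [flagBlocks_cons]
    have h := (invCount_append_Ico (p := flagBlocks (o + 1) f) (j := o + 1)
      (fun i hi => le_of_mem_flagBlocks hi) (ih (o + 1) f) (k - (o + 1))).2.2
    rw [List.length_append, List.Ico.length, ← h]
    rcases le_total (o + 1) k with hk | hk
    · rw [Nat.add_sub_cancel' hk]
    · rw [Nat.sub_eq_zero_of_le hk, add_zero, List.Ico.eq_nil_of_le hk, List.Ico.self_empty]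

theorem isReducedExpression_flagWord {r : ℕ} (f : Fin r → ℕ) :
    IsReducedExpression (flagWord f) (wordProd (flagWord f)) := by
  rw [isReducedExpression_iff, ← flagBlocks_zero]
  exact ⟨⟨fun i hi => le_of_mem_flagBlocks hi, rfl⟩, (invCount_flagBlocks 0 f).symm⟩

/-! ### Sums over one row of entries `k` and `k + 1` -/

theorem one_add_beta_mul_oplus (u v : PolyXB) :
    1 + betaVar * oplus u v = (1 + betaVar * u) * (1 + betaVar * v) := by
  rw [oplus]; ring

theorem prod_Ioc_succ_shift {M : Type*} [CommMonoid M] (f : ℕ → M) {m n : ℕ} (h : m ≤ n) :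
    ∏ c ∈ Finset.Ioc m (n + 1), f c = f (m + 1) * ∏ c ∈ Finset.Ioc m n, f (c + 1) := by
  induction n, h using Nat.le_induction with
  | base => simp
  | succ n h ih =>
    rw [Finset.prod_Ioc_succ_top (by omega), ih, Finset.prod_Ioc_succ_top h, mul_assoc]

/-- `∏_{m < c ≤ n} (u ⊕ b_c)`. -/
def runProd (u : PolyXB) (b : ℕ → PolyXB) (m n : ℕ) : PolyXB :=
  ∏ c ∈ Finset.Ioc m n, oplus u (b c)

theorem runProd_self (u : PolyXB) (b : ℕ → PolyXB) (m : ℕ) : runProd u b m m = 1 := by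
  simp [runProd]

theorem runProd_succ (u : PolyXB) (b : ℕ → PolyXB) {m n : ℕ} (h : m ≤ n) :
    runProd u b m (n + 1) = runProd u b m n * oplus u (b (n + 1)) :=
  Finset.prod_Ioc_succ_top h _

theorem runProd_succ_shift (u : PolyXB) (b : ℕ → PolyXB) {m n : ℕ} (h : m ≤ n) :
    runProd u b m (n + 1) = oplus u (b (m + 1)) * runProd u (fun c => b (c + 1)) m n :=
  prod_Ioc_succ_shift _ h

theorem runProd_mul (u : PolyXB) (b : ℕ → PolyXB) {l m n : ℕ} (h : l ≤ m) (h' : m ≤ n) :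
    runProd u b l m * runProd u b m n = runProd u b l n :=
  Finset.prod_Ioc_consecutive _ h h'

theorem swapX_runProd {k : ℕ} {b : ℕ → PolyXB} (hb : ∀ c, swapX k (b c) = b c) (m n : ℕ) :
    swapX k (runProd (varX k) b m n) = runProd (varX (k + 1)) b m n := by
  simp only [runProd, map_prod, swapX_oplus, swapX_varX_left, hb]

/-- The weight of a part of a row whose columns `lo + 1, …, hi` hold first `x`'s, up to column `κ`,
and then `y`'s, the index of `b` being one higher for the latter. -/
def splitProd (x y : PolyXB) (b : ℕ → PolyXB) (lo κ hi : ℕ) : PolyXB :=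
  runProd x b lo κ * runProd y (fun c => b (c + 1)) κ hi

/-- `∑_κ splitProd lo κ hi * (1 + β b_{κ + 1})`, which telescopes. -/
def splitSum (x y : PolyXB) (b : ℕ → PolyXB) (lo hi : ℕ) : PolyXB :=
  ∑ κ ∈ Finset.Icc lo hi, splitProd x y b lo κ hi * (1 + betaVar * b (κ + 1))

theorem sub_mul_splitSum (x y : PolyXB) (b : ℕ → PolyXB) {lo hi : ℕ} (h : lo ≤ hi) :
    (x - y) * splitSum x y b lo hi = runProd x b lo (hi + 1) - runProd y b lo (hi + 1) := by
  induction hi, h using Nat.le_induction with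
  | base =>
    rw [runProd_succ _ _ le_rfl, runProd_succ _ _ le_rfl, runProd_self, runProd_self]
    simp only [splitSum, splitProd, Finset.Icc_self, Finset.sum_singleton, runProd_self, oplus]
    ring
  | succ n h ih =>
    have e : splitSum x y b lo (n + 1) = splitSum x y b lo n * oplus y (b (n + 1 + 1)) +
        runProd x b lo (n + 1) * (1 + betaVar * b (n + 1 + 1)) := by
      rw [splitSum, ← Finset.insert_Icc_right_eq_Icc_add_one (by omega : lo ≤ n + 1),
        Finset.sum_insert (by simp), add_comm, splitSum, Finset.sum_mul]
      refine congrArg₂ (· + ·) ?_ ?_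
      · refine Finset.sum_congr rfl fun κ hκ => ?_
        rw [splitProd, runProd_succ _ _ (Finset.mem_Icc.1 hκ).2, splitProd]
        ring
      · rw [splitProd, runProd_self, mul_one]
    rw [e, runProd_succ x b (show lo ≤ n + 1 by omega),
      runProd_succ y b (show lo ≤ n + 1 by omega), mul_add, ← mul_assoc, ih]
    simp only [oplus]
    ring

section RowSums

variable {k : ℕ} {b : ℕ → PolyXB}

theorem dividedDiff_one_add_mul_runProd (hb : ∀ c, swapX k (b c) = b c) {lo hi : ℕ}
    (h : lo ≤ hi) :
    dividedDiff k ((1 + betaVar * varX k) * runProd (varX k) b lo (hi + 1)) =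
      (1 + betaVar * varX k) * (1 + betaVar * varX (k + 1)) *
        splitSum (varX k) (varX (k + 1)) b lo hi := by
  apply dividedDiff_unique
  have e := sub_mul_splitSum (varX k) (varX (k + 1)) b h
  simp only [map_mul, map_add, map_one, swapX_betaVar, swapX_varX_left, swapX_runProd hb]
  linear_combination (1 + betaVar * varX k) * (1 + betaVar * varX (k + 1)) * e

theorem dividedDiff_runProd (hb : ∀ c, swapX k (b c) = b c) {lo hi : ℕ} (h : lo ≤ hi) :
    dividedDiff k (runProd (varX k) b lo (hi + 1)) =
      (1 + betaVar * varX (k + 1)) * splitSum (varX k) (varX (k + 1)) b lo hi -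
        betaVar * runProd (varX (k + 1)) b lo (hi + 1) := by
  apply dividedDiff_unique
  have e := sub_mul_splitSum (varX k) (varX (k + 1)) b h
  rw [swapX_runProd hb]
  linear_combination (1 + betaVar * varX (k + 1)) * e

theorem dividedDiff_runProd' (hb : ∀ c, swapX k (b c) = b c) {lo hi : ℕ} (h : lo ≤ hi) :
    dividedDiff k (runProd (varX k) b lo (hi + 1)) =
      (1 + betaVar * varX k) * splitSum (varX k) (varX (k + 1)) b lo hi -
        betaVar * runProd (varX k) b lo (hi + 1) := by
  rw [dividedDiff_runProd hb h]
  linear_combination -betaVar * sub_mul_splitSum (varX k) (varX (k + 1)) b h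

theorem dividedDiff_one_add_mul_runProd' (hb : ∀ c, swapX k (b c) = b c) (lo hi : ℕ) :
    dividedDiff k ((1 + betaVar * varX (k + 1)) * runProd (varX k) b lo (hi + 1)) =
      (1 + betaVar * varX k) * dividedDiff k (runProd (varX k) b lo (hi + 1)) -
        betaVar * (1 + betaVar * varX (k + 1)) * runProd (varX k) b lo (hi + 1) := by
  apply dividedDiff_unique
  have e := dividedDiff_spec k (runProd (varX k) b lo (hi + 1))
  rw [swapX_runProd hb] at e
  simp only [map_mul, map_add, map_one, swapX_betaVar, swapX_varX_right, swapX_runProd hb]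
  linear_combination (1 + betaVar * varX k) * e

/-- The sum in which an additional entry `k + 1` is always available on the last box of the
`k`-part of the row; below, such an additional entry is called a mark. -/
theorem sum_splitProd_mark (lo hi : ℕ) :
    ∑ κ ∈ Finset.Icc lo hi, splitProd (varX k) (varX (k + 1)) b lo κ hi *
        (1 + betaVar * oplus (varX (k + 1)) (b (κ + 1))) =
      (1 + betaVar * varX (k + 1)) * splitSum (varX k) (varX (k + 1)) b lo hi := by
  rw [splitSum, Finset.mul_sum]
  refine Finset.sum_congr rfl fun κ _ => ?_
  rw [one_add_beta_mul_oplus]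
  ring

/-- The mark of value `k + 1` is not available for `κ = lo`. -/
theorem sum_splitProd_mark_of_lt (hb : ∀ c, swapX k (b c) = b c) {lo hi : ℕ} (h : lo ≤ hi) :
    ∑ κ ∈ Finset.Icc lo hi, splitProd (varX k) (varX (k + 1)) b lo κ hi *
        (if lo < κ then 1 + betaVar * oplus (varX (k + 1)) (b (κ + 1)) else 1) =
      dividedDiff k (runProd (varX k) b lo (hi + 1)) := by
  rw [dividedDiff_runProd hb h, ← sum_splitProd_mark, ← Finset.add_sum_Ioc_eq_sum_Icc h,
    ← Finset.add_sum_Ioc_eq_sum_Icc h, runProd_succ_shift _ _ h]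
  rw [Finset.sum_congr rfl fun κ hκ => by rw [if_pos (Finset.mem_Ioc.1 hκ).1]]
  simp only [lt_irrefl, if_false, splitProd, runProd_self]
  ring

/-- The effect of the mark of value `k` on the last box of the row above, whose weight is
`x_k ⊕ b_{hi + 1}` and which is available only for `κ < hi`. -/
theorem sum_splitProd_upper {lo hi : ℕ} (h : lo ≤ hi) (φ : ℕ → PolyXB) :
    ∑ κ ∈ Finset.Icc lo hi, (if κ < hi then 1 + betaVar * oplus (varX k) (b (hi + 1)) else 1) *
        (splitProd (varX k) (varX (k + 1)) b lo κ hi * φ κ) =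
      (1 + betaVar * varX k) * (1 + betaVar * b (hi + 1)) *
        (∑ κ ∈ Finset.Icc lo hi, splitProd (varX k) (varX (k + 1)) b lo κ hi * φ κ) -
      betaVar * runProd (varX k) b lo (hi + 1) * φ hi := by
  rw [← Finset.sum_Ico_add_eq_sum_Icc h, ← Finset.sum_Ico_add_eq_sum_Icc h,
    runProd_succ _ _ h, ← one_add_beta_mul_oplus,
    Finset.sum_congr rfl fun κ hκ => by rw [if_pos (Finset.mem_Ico.1 hκ).2], ← Finset.mul_sum]
  simp only [lt_irrefl, if_false, splitProd, runProd_self]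
  ring

theorem sum_splitProd_upper_mark (hb : ∀ c, swapX k (b c) = b c) {lo hi : ℕ} (h : lo ≤ hi) :
    ∑ κ ∈ Finset.Icc lo hi, (if κ < hi then 1 + betaVar * oplus (varX k) (b (hi + 1)) else 1) *
        (splitProd (varX k) (varX (k + 1)) b lo κ hi *
          (1 + betaVar * oplus (varX (k + 1)) (b (κ + 1)))) =
      (1 + betaVar * varX (k + 1)) * (1 + betaVar * b (hi + 1)) *
        dividedDiff k (runProd (varX k) b lo (hi + 1)) := by
  rw [sum_splitProd_upper h, sum_splitProd_mark, dividedDiff_runProd' hb h,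
    one_add_beta_mul_oplus]
  ring

theorem sum_splitProd_upper_mark_of_lt (hb : ∀ c, swapX k (b c) = b c) {lo hi : ℕ}
    (h : lo < hi) :
    ∑ κ ∈ Finset.Icc lo hi, (if κ < hi then 1 + betaVar * oplus (varX k) (b (hi + 1)) else 1) *
        (splitProd (varX k) (varX (k + 1)) b lo κ hi *
          (if lo < κ then 1 + betaVar * oplus (varX (k + 1)) (b (κ + 1)) else 1)) =
      (1 + betaVar * b (hi + 1)) *
        dividedDiff k ((1 + betaVar * varX (k + 1)) * runProd (varX k) b lo (hi + 1)) := by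
  rw [sum_splitProd_upper h.le, sum_splitProd_mark_of_lt hb h.le,
    dividedDiff_one_add_mul_runProd' hb, if_pos h, one_add_beta_mul_oplus]
  ring

end RowSums

/-! ### Transfer weights -/

/-- `x_v ⊕ b_{v + c - (i + 1)}`, the weight of an entry `v` in column `c` (counted from `1`) of
row `i` (counted from `0`). -/
def entryWt (v i c : ℕ) : PolyXB := oplus (varX v) (varB (v + c - (i + 1)))

/-- The weight of entries `v` in the columns `m + 1, …, n` of row `i`; zero if `n < m`. -/
def stripWt (v i m n : ℕ) : PolyXB := if m ≤ n then ∏ c ∈ Finset.Ioc m n, entryWt v i c else 0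

/-- The weight of the optional additional entry `v` in the last one of `m` boxes of row `i`, when
the row below is to have `n` boxes: it is available only if the box below is not occupied. The
weight is zero if `m < n`. -/
def cornerWt (v i m n : ℕ) : PolyXB :=
  if n < m then 1 + betaVar * entryWt v i m else if n = m then 1 else 0

/-- The weight of the entries `v` in row `i`, when the boxes with an entry below `v` are the first
`m` ones, those with an entry at most `v` are the first `n` ones, and in the row below these are
the first `n'` ones. The entry `v` is admitted in this row only if `act` holds. -/
def rowWt (v : ℕ) (act : Prop) [Decidable act] (i m n n' : ℕ) : PolyXB :=
  if act then stripWt v i m n * cornerWt v i m n' else if m = n ∧ n' ≤ m then 1 else 0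

/-- The length of row `i` of the shape `ν`, rows beyond the last one having length `0`. -/
def rowLen {r : ℕ} (ν : Fin r → ℕ) (i : ℕ) : ℕ := if h : i < r then ν ⟨i, h⟩ else 0

/-- The weight of the entries `v` in a tableau with flags `f` whose boxes with an entry below `v`
form the shape `μ` and whose boxes with an entry at most `v` form the shape `ν`; the rows are
numbered from `o` on. -/
def transferWt (v o : ℕ) {r : ℕ} (f μ ν : Fin r → ℕ) : PolyXB :=
  ∏ i : Fin r, rowWt v (v ≤ f i) (o + i) (μ i) (ν i) (rowLen ν (i + 1))

/-- The generating function of the tableaux of shape `ν` with flags `f` and with values in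
`o + 1, …, o + t`, built up value by value; the rows are numbered from `o` on. -/
def chainSum (o : ℕ) {r : ℕ} (f : Fin r → ℕ) : ℕ → (Fin r → ℕ) → PolyXB
  | 0, ν => if ν = 0 then 1 else 0
  | t + 1, ν => ∑ μ ∈ Finset.Iic ν, chainSum o f t μ * transferWt (o + t + 1) o f μ ν

theorem chainSum_zero (o : ℕ) {r : ℕ} (f ν : Fin r → ℕ) :
    chainSum o f 0 ν = if ν = 0 then 1 else 0 := rfl

theorem chainSum_succ (o : ℕ) {r : ℕ} (f : Fin r → ℕ) (t : ℕ) (ν : Fin r → ℕ) :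
    chainSum o f (t + 1) ν =
      ∑ μ ∈ Finset.Iic ν, chainSum o f t μ * transferWt (o + t + 1) o f μ ν := rfl

theorem rowLen_cons_zero {r : ℕ} (a : ℕ) (ν : Fin r → ℕ) :
    rowLen (Fin.cons a ν : Fin (r + 1) → ℕ) 0 = a := by
  simp [rowLen]

theorem rowLen_cons_succ {r : ℕ} (a : ℕ) (ν : Fin r → ℕ) (i : ℕ) :
    rowLen (Fin.cons a ν : Fin (r + 1) → ℕ) (i + 1) = rowLen ν i := by
  simp only [rowLen, add_lt_add_iff_right]
  split_ifs with h
  · exact Fin.cons_succ (α := fun _ => ℕ) a ν ⟨i, h⟩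
  · rfl

theorem rowLen_apply {r : ℕ} (ν : Fin r → ℕ) (i : Fin r) : rowLen ν i = ν i := by
  simp [rowLen]

theorem rowLen_mono {r : ℕ} {μ ν : Fin r → ℕ} (h : μ ≤ ν) (i : ℕ) : rowLen μ i ≤ rowLen ν i := by
  simp only [rowLen]
  split_ifs
  · exact h _
  · exact le_rfl

theorem transferWt_cons (v o : ℕ) {r : ℕ} (k m n : ℕ) (f μ ν : Fin r → ℕ) :
    transferWt v o (Fin.cons k f : Fin (r + 1) → ℕ) (Fin.cons m μ) (Fin.cons n ν) =
      rowWt v (v ≤ k) o m n (rowLen ν 0) * transferWt v (o + 1) f μ ν := by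
  rw [transferWt, Fin.prod_univ_succ]
  refine congrArg₂ (· * ·) ?_ ?_
  · simp only [Fin.cons_zero, Fin.val_zero, add_zero, zero_add]
    exact congrArg _ (rowLen_cons_succ n ν 0)
  · refine Finset.prod_congr rfl fun i _ => ?_
    simp only [Fin.cons_succ, Fin.val_succ, rowLen_cons_succ]
    rw [add_right_comm, ← add_assoc]

theorem sum_Iic_cons {M : Type*} [AddCommMonoid M] {r : ℕ} (a : ℕ) (ν : Fin r → ℕ)
    (g : (Fin (r + 1) → ℕ) → M) :
    ∑ μ ∈ Finset.Iic (Fin.cons a ν : Fin (r + 1) → ℕ), g μ =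
      ∑ m ∈ Finset.Iic a, ∑ μ ∈ Finset.Iic ν, g (Fin.cons m μ) := by
  rw [← Finset.sum_product']
  refine Finset.sum_bij' (fun μ _ => (μ 0, Fin.tail μ)) (fun p _ => Fin.cons p.1 p.2)
    ?_ ?_ ?_ ?_ ?_
  · intro μ hμ
    rw [Finset.mem_Iic] at hμ
    simp only [Finset.mem_product, Finset.mem_Iic]
    exact ⟨hμ 0, fun i => hμ i.succ⟩
  · intro p hp
    simp only [Finset.mem_product, Finset.mem_Iic] at hp
    rw [Finset.mem_Iic]
    intro i
    refine Fin.cases ?_ (fun j => ?_) i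
    · exact hp.1
    · exact hp.2 j
  · intro μ _
    exact Fin.cons_self_tail μ
  · intro p _
    simp
  · intro μ _
    rw [Fin.cons_self_tail]

theorem stripWt_of_lt {v i m n : ℕ} (h : n < m) : stripWt v i m n = 0 :=
  if_neg (not_le.2 h)

theorem stripWt_of_le {v i m n : ℕ} (h : m ≤ n) :
    stripWt v i m n = runProd (varX v) (fun c => varB (v + c - (i + 1))) m n :=
  if_pos h

theorem stripWt_self (v i m : ℕ) : stripWt v i m m = 1 := by
  rw [stripWt_of_le le_rfl, runProd_self]

theorem cornerWt_of_gt {v i m n : ℕ} (h : m < n) : cornerWt v i m n = 0 := by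
  rw [cornerWt, if_neg (by omega), if_neg (by omega)]

theorem cornerWt_of_le {v i m n : ℕ} (h : n ≤ m) :
    cornerWt v i m n = if n < m then 1 + betaVar * entryWt v i m else 1 := by
  rw [cornerWt]
  split_ifs <;> first | rfl | omega

theorem rowWt_of_pos {v i m n n' : ℕ} {act : Prop} [Decidable act] (h : act) :
    rowWt v act i m n n' = stripWt v i m n * cornerWt v i m n' := if_pos h

theorem rowWt_of_neg {v i m n n' : ℕ} {act : Prop} [Decidable act] (h : ¬ act) :
    rowWt v act i m n n' = if m = n ∧ n' ≤ m then 1 else 0 := if_neg h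

theorem rowWt_eq_zero {v i m n n' : ℕ} {act : Prop} [Decidable act] (h : ¬ (m ≤ n ∧ n' ≤ m)) :
    rowWt v act i m n n' = 0 := by
  rw [rowWt]
  split_ifs with h1 h2
  · rcases not_and_or.1 h with h | h
    · rw [stripWt_of_lt (by omega), zero_mul]
    · rw [cornerWt_of_gt (by omega), mul_zero]
  · omega
  · rfl

theorem transferWt_eq_zero {v o r : ℕ} {f μ ν : Fin r → ℕ} (i : Fin r)
    (h : ¬ (μ i ≤ ν i ∧ rowLen ν (i + 1) ≤ μ i)) : transferWt v o f μ ν = 0 :=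
  Finset.prod_eq_zero (Finset.mem_univ i) (rowWt_eq_zero h)

theorem le_of_transferWt_ne_zero {v o r : ℕ} {f μ ν : Fin r → ℕ}
    (h : transferWt v o f μ ν ≠ 0) : μ ≤ ν := by
  intro i
  by_contra hi
  exact h (transferWt_eq_zero i fun h => hi h.1)

theorem swapX_entryWt {k v i c : ℕ} (h1 : v ≠ k) (h2 : v ≠ k + 1) :
    swapX k (entryWt v i c) = entryWt v i c := by
  rw [entryWt, swapX_oplus, swapX_varX_of_ne h1 h2, swapX_varB]

theorem swapX_transferWt {k v o r : ℕ} (h1 : v ≠ k) (h2 : v ≠ k + 1) (f μ ν : Fin r → ℕ) :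
    swapX k (transferWt v o f μ ν) = transferWt v o f μ ν := by
  simp only [transferWt, map_prod]
  refine Finset.prod_congr rfl fun i _ => ?_
  simp only [rowWt, stripWt, cornerWt]
  split_ifs <;> simp [map_prod, swapX_entryWt h1 h2]

theorem sum_Iic_eq_sum_Icc {M : Type*} [AddCommMonoid M] {lo hi ν : ℕ} (h : hi ≤ ν) (g : ℕ → M)
    (h0 : ∀ κ, ¬ (lo ≤ κ ∧ κ ≤ hi) → κ ≤ ν → g κ = 0) :
    ∑ κ ∈ Finset.Iic ν, g κ = ∑ κ ∈ Finset.Icc lo hi, g κ := by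
  symm
  refine Finset.sum_subset (fun κ hκ => ?_) fun κ hκ hκ' => ?_
  · rw [Finset.mem_Icc] at hκ
    rw [Finset.mem_Iic]
    omega
  · rw [Finset.mem_Iic] at hκ
    rw [Finset.mem_Icc] at hκ'
    exact h0 κ hκ' hκ

/-! ### Symmetry of two consecutive values -/

/-- The part of the weight of row `i` that has to be combined with row `i + 1` in order to obtain
symmetric polynomials. Here row `i` has `m` boxes with an entry below `k`, and row `i + 1` has `n`
boxes with an entry at most `k + 1`. If `m ≤ n`, the columns `m + 1, …, n` hold `k` above `k + 1`.
If `n < m`, the corners of row `i` are free to hold an additional `k` and an additional `k + 1`, and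
the factor `1 + β x_{k + 1}` of the latter matches the factor `1 + β x_k` of the former. -/
def edgeWt (k i m n : ℕ) : PolyXB :=
  if n < m then 1 + betaVar * varX (k + 1) else ∏ c ∈ Finset.Ioc m n, entryWt k i c

theorem entryWt_succ_row (k i c : ℕ) :
    entryWt k i c = oplus (varX k) (varB (k + (c + 1) - (i + 1 + 1))) := by
  rw [entryWt, ← add_assoc, Nat.add_sub_add_right]

theorem entryWt_succ (k i c : ℕ) :
    entryWt (k + 1) i c = oplus (varX (k + 1)) (varB (k + (c + 1) - (i + 1))) := by
  rw [entryWt, add_right_comm, add_assoc]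

/-- A vertical pair `k` over `k + 1` has a symmetric weight, as the indices of `b` agree. -/
theorem swapX_vertical_pair (k i c : ℕ) :
    swapX k (entryWt k i c * entryWt (k + 1) (i + 1) c) =
      entryWt k i c * entryWt (k + 1) (i + 1) c := by
  rw [entryWt_succ_row, entryWt_succ]
  simp only [map_mul, swapX_oplus, swapX_varX_left, swapX_varX_right, swapX_varB]
  rw [mul_comm]

theorem swapX_prod_vertical_pair (k i m n : ℕ) :
    swapX k (∏ c ∈ Finset.Ioc m n, entryWt k i c * entryWt (k + 1) (i + 1) c) =
      ∏ c ∈ Finset.Ioc m n, entryWt k i c * entryWt (k + 1) (i + 1) c := by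
  rw [map_prod]
  exact Finset.prod_congr rfl fun c _ => swapX_vertical_pair k i c

theorem swapX_one_add_mul (k : ℕ) :
    swapX k ((1 + betaVar * varX k) * (1 + betaVar * varX (k + 1))) =
      (1 + betaVar * varX k) * (1 + betaVar * varX (k + 1)) := by
  simp only [map_mul, map_add, map_one, swapX_betaVar, swapX_varX_left, swapX_varX_right]
  ring

theorem strip_mul_strip {k i μ κ ν lo hi : ℕ} (h1 : μ ≤ lo) (h2 : lo ≤ κ) (h3 : κ ≤ hi)
    (h4 : hi ≤ ν) :
    stripWt k i μ κ * stripWt (k + 1) i κ ν =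
      (∏ c ∈ Finset.Ioc μ lo, entryWt k i c) * (∏ c ∈ Finset.Ioc hi ν, entryWt (k + 1) i c) *
        splitProd (varX k) (varX (k + 1)) (fun c => varB (k + c - (i + 1))) lo κ hi := by
  have e1 : stripWt k i μ κ = (∏ c ∈ Finset.Ioc μ lo, entryWt k i c) *
      runProd (varX k) (fun c => varB (k + c - (i + 1))) lo κ := by
    rw [stripWt_of_le (h1.trans h2), ← runProd_mul _ _ h1 h2]
    rfl
  have e2 : stripWt (k + 1) i κ ν =
      runProd (varX (k + 1)) (fun c => varB (k + (c + 1) - (i + 1))) κ hi *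
        ∏ c ∈ Finset.Ioc hi ν, entryWt (k + 1) i c := by
    simp only [stripWt, if_pos (h3.trans h4), entryWt_succ, runProd]
    exact (Finset.prod_Ioc_consecutive _ h3 h4).symm
  rw [e1, e2, splitProd]
  ring

/-- The sum over all ways to fill the columns `μ + 1, …, ν` of row `i + 1` with entries `k`, up to
column `κ`, and `k + 1`. It includes the optional entry `k` in the last one of the `m` boxes of row
`i`, and the optional `k + 1` in column `κ`, above a row with `n` boxes. -/
def rowSum (k i m μ ν n : ℕ) : PolyXB :=
  ∑ κ ∈ Finset.Iic ν, cornerWt k i m κ * (stripWt k (i + 1) μ κ *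
    stripWt (k + 1) (i + 1) κ ν * cornerWt (k + 1) (i + 1) κ n)

/-- Up to the factors tying a row to its neighbours above and below, `rowSum` is symmetric in `x_k`
and `x_{k+1}`. -/
theorem rowSum_symm (k i m μ ν n : ℕ) :
    ∃ S, swapX k S = S ∧ edgeWt k i m ν * rowSum k i m μ ν n = edgeWt k (i + 1) μ n * S := by
  have hsum : rowSum k i m μ ν n = ∑ κ ∈ Finset.Icc (max μ n) (min ν m),
      cornerWt k i m κ * (stripWt k (i + 1) μ κ *
        stripWt (k + 1) (i + 1) κ ν * cornerWt (k + 1) (i + 1) κ n) := by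
    refine sum_Iic_eq_sum_Icc (min_le_left _ _) _ fun κ h1 h2 => ?_
    rcases lt_or_ge κ μ with h | h
    · rw [stripWt_of_lt h]; ring
    rcases lt_or_ge κ n with h' | h'
    · rw [cornerWt_of_gt h']; ring
    · rw [cornerWt_of_gt (show m < κ by simp only [max_le_iff, le_min_iff] at h1; omega)]; ring
  rcases lt_or_ge (min ν m) (max μ n) with hlt | hle
  · exact ⟨0, map_zero _, by rw [hsum, Finset.Icc_eq_empty (not_le.2 hlt)]; simp⟩
  set b : ℕ → PolyXB := fun c => varB (k + c - (i + 1 + 1)) with hbdef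
  have hb : ∀ c, swapX k (b c) = b c := fun c => swapX_varB _ _
  have hterm : ∀ κ ∈ Finset.Icc (max μ n) (min ν m),
      cornerWt k i m κ * (stripWt k (i + 1) μ κ *
        stripWt (k + 1) (i + 1) κ ν * cornerWt (k + 1) (i + 1) κ n) =
      (∏ c ∈ Finset.Ioc μ (max μ n), entryWt k (i + 1) c) *
        (∏ c ∈ Finset.Ioc (min ν m) ν, entryWt (k + 1) (i + 1) c) *
      ((if κ < m then 1 + betaVar * oplus (varX k) (b (m + 1)) else 1) *
      (splitProd (varX k) (varX (k + 1)) b (max μ n) κ (min ν m) *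
        (if n < κ then 1 + betaVar * oplus (varX (k + 1)) (b (κ + 1)) else 1))) := by
    intro κ hκ
    rw [Finset.mem_Icc] at hκ
    rw [strip_mul_strip (le_max_left _ _) hκ.1 hκ.2 (min_le_left _ _),
      cornerWt_of_le (hκ.2.trans (min_le_right _ _)),
      cornerWt_of_le ((le_max_right _ _).trans hκ.1),
      entryWt_succ_row, entryWt_succ]
    ring
  rw [hsum, Finset.sum_congr rfl hterm, ← Finset.mul_sum]
  clear hsum hterm
  have hx := swapX_one_add_mul k
  have hpair := swapX_prod_vertical_pair k i m ν
  -- `n < μ`: the optional `k + 1` is available for every `κ`; otherwise not for `κ = n`.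
  -- `ν < m`: the optional `k` above is available for every `κ`; otherwise not for `κ = m`.
  rcases lt_or_ge n μ with hn | hn <;> rcases lt_or_ge ν m with hm | hm
  · rw [max_eq_left hn.le, min_eq_left hm.le] at *
    refine ⟨(1 + betaVar * b (m + 1)) *
      dividedDiff k ((1 + betaVar * varX k) * runProd (varX k) b μ (ν + 1)), ?_, ?_⟩
    · simp [swapX_dividedDiff, hb]
    · have e : ∀ κ ∈ Finset.Icc μ ν,
          (if κ < m then 1 + betaVar * oplus (varX k) (b (m + 1)) else 1) *
            (splitProd (varX k) (varX (k + 1)) b μ κ ν *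
              (if n < κ then 1 + betaVar * oplus (varX (k + 1)) (b (κ + 1)) else 1)) =
          (1 + betaVar * oplus (varX k) (b (m + 1))) *
            (splitProd (varX k) (varX (k + 1)) b μ κ ν *
              (1 + betaVar * oplus (varX (k + 1)) (b (κ + 1)))) := by
        intro κ hκ
        rw [Finset.mem_Icc] at hκ
        rw [if_pos (show κ < m by omega), if_pos (show n < κ by omega)]
      rw [Finset.sum_congr rfl e,
        ← Finset.mul_sum, sum_splitProd_mark, dividedDiff_one_add_mul_runProd hb hle,
        edgeWt, edgeWt, if_pos hm, if_pos hn, one_add_beta_mul_oplus]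
      simp only [Finset.Ioc_self, Finset.prod_empty]
      ring
  · rw [max_eq_left hn.le, min_eq_right hm] at *
    refine ⟨(∏ c ∈ Finset.Ioc m ν, entryWt k i c * entryWt (k + 1) (i + 1) c) *
      ((1 + betaVar * b (m + 1)) * dividedDiff k (runProd (varX k) b μ (m + 1))), ?_, ?_⟩
    · rw [map_mul, hpair]
      simp [swapX_dividedDiff, hb]
    · have e : ∀ κ ∈ Finset.Icc μ m,
          (if κ < m then 1 + betaVar * oplus (varX k) (b (m + 1)) else 1) *
            (splitProd (varX k) (varX (k + 1)) b μ κ m *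
              (if n < κ then 1 + betaVar * oplus (varX (k + 1)) (b (κ + 1)) else 1)) =
          (if κ < m then 1 + betaVar * oplus (varX k) (b (m + 1)) else 1) *
            (splitProd (varX k) (varX (k + 1)) b μ κ m *
              (1 + betaVar * oplus (varX (k + 1)) (b (κ + 1)))) := by
        intro κ hκ
        rw [Finset.mem_Icc] at hκ
        rw [if_pos (show n < κ by omega)]
      rw [Finset.sum_congr rfl e,
        sum_splitProd_upper_mark hb hle, edgeWt, edgeWt, if_neg (by omega), if_pos hn,
        Finset.prod_mul_distrib]
      simp only [Finset.Ioc_self, Finset.prod_empty]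
      ring
  · rw [max_eq_right hn, min_eq_left hm.le] at *
    refine ⟨(1 + betaVar * varX k) * (1 + betaVar * varX (k + 1)) * ((1 + betaVar * b (m + 1)) *
      dividedDiff k (runProd (varX k) b n (ν + 1))), ?_, ?_⟩
    · rw [map_mul, hx]
      simp [swapX_dividedDiff, hb]
    · have e : ∀ κ ∈ Finset.Icc n ν,
          (if κ < m then 1 + betaVar * oplus (varX k) (b (m + 1)) else 1) *
            (splitProd (varX k) (varX (k + 1)) b n κ ν *
              (if n < κ then 1 + betaVar * oplus (varX (k + 1)) (b (κ + 1)) else 1)) =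
          (1 + betaVar * oplus (varX k) (b (m + 1))) *
            (splitProd (varX k) (varX (k + 1)) b n κ ν *
              (if n < κ then 1 + betaVar * oplus (varX (k + 1)) (b (κ + 1)) else 1)) := by
        intro κ hκ
        rw [Finset.mem_Icc] at hκ
        rw [if_pos (show κ < m by omega)]
      rw [Finset.sum_congr rfl e,
        ← Finset.mul_sum, sum_splitProd_mark_of_lt hb hle,
        edgeWt, edgeWt, if_pos hm, if_neg (by omega), one_add_beta_mul_oplus]
      simp only [Finset.Ioc_self, Finset.prod_empty]
      ring
  · rw [max_eq_right hn, min_eq_right hm] at *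
    rcases hle.eq_or_lt with rfl | hlt
    · refine ⟨∏ c ∈ Finset.Ioc n ν, entryWt k i c * entryWt (k + 1) (i + 1) c, hpair, ?_⟩
      rw [edgeWt, edgeWt, if_neg (by omega), if_neg (by omega), Finset.prod_mul_distrib]
      simp only [Finset.Icc_self, Finset.sum_singleton, lt_irrefl, if_false, splitProd,
        runProd_self]
      ring
    · refine ⟨(∏ c ∈ Finset.Ioc m ν, entryWt k i c * entryWt (k + 1) (i + 1) c) *
        ((1 + betaVar * b (m + 1)) *
          dividedDiff k ((1 + betaVar * varX (k + 1)) * runProd (varX k) b n (m + 1))), ?_, ?_⟩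
      · rw [map_mul, hpair]
        simp [swapX_dividedDiff, hb]
      · rw [sum_splitProd_upper_mark_of_lt hb hlt, edgeWt, edgeWt, if_neg (by omega),
          if_neg (by omega), Finset.prod_mul_distrib]
        ring

/-- The sum over all ways to fill the rows `o + 1, o + 2, …` with entries `k` and `k + 1`, together
with the optional entry `k` in the last one of the `m` boxes of row `o`. -/
def lowerSum (k o m : ℕ) {r : ℕ} (f μ ν : Fin r → ℕ) : PolyXB :=
  ∑ κ ∈ Finset.Iic ν, cornerWt k o m (rowLen κ 0) *
    (transferWt k (o + 1) f μ κ * transferWt (k + 1) (o + 1) f κ ν)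

/-- The rows decouple. -/
theorem lowerSum_cons {k o m r l a n : ℕ} {f : Fin r → ℕ} (hl : k + 1 ≤ l) (μ ν : Fin r → ℕ) :
    lowerSum k o m (Fin.cons l f : Fin (r + 1) → ℕ) (Fin.cons a μ) (Fin.cons n ν) =
      rowSum k o m a n (rowLen ν 0) * lowerSum k (o + 1) a f μ ν := by
  rw [lowerSum, sum_Iic_cons, rowSum, lowerSum, Finset.sum_mul_sum]
  refine Finset.sum_congr rfl fun κ₀ _ => Finset.sum_congr rfl fun κ _ => ?_
  rw [transferWt_cons, transferWt_cons, rowWt_of_pos hl, rowWt_of_pos (by omega),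
    rowLen_cons_zero]
  ring

theorem Iic_fin_zero (ν : Fin 0 → ℕ) : Finset.Iic ν = {ν} := by
  ext μ
  simp [Subsingleton.elim μ ν]

/-- If the values `k` and `k + 1` are admitted in all rows below, then these rows, with the part of
the row above that is tied to them, contribute a polynomial symmetric in `x_k` and `x_{k+1}`. -/
theorem swapX_edgeWt_mul_lowerSum {k r : ℕ} (o m : ℕ) {f : Fin r → ℕ} (hf : ∀ i, k + 1 ≤ f i)
    (μ ν : Fin r → ℕ) :
    swapX k (edgeWt k o m (rowLen ν 0) * lowerSum k o m f μ ν) =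
      edgeWt k o m (rowLen ν 0) * lowerSum k o m f μ ν := by
  induction r generalizing o m with
  | zero =>
    have h0 : ∀ κ : Fin 0 → ℕ, rowLen κ 0 = 0 := fun κ => rfl
    simp only [lowerSum, Iic_fin_zero, Finset.sum_singleton, h0, transferWt,
      Finset.univ_eq_empty, Finset.prod_empty, mul_one, edgeWt, cornerWt_of_le (Nat.zero_le m)]
    split_ifs with hm
    · have e : (1 + betaVar * varX (k + 1)) * (1 + betaVar * entryWt k o m) =
          (1 + betaVar * varX k) * (1 + betaVar * varX (k + 1)) *
            (1 + betaVar * varB (k + m - (o + 1))) := by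
        rw [entryWt, one_add_beta_mul_oplus]
        ring
      rw [e, map_mul, swapX_one_add_mul]
      simp
    · simp
  | succ r ih =>
    obtain ⟨l, f, rfl⟩ : ∃ l f', f = Fin.cons l f' := ⟨f 0, Fin.tail f, (Fin.cons_self_tail f).symm⟩
    obtain ⟨a, μ, rfl⟩ : ∃ a μ', μ = Fin.cons a μ' := ⟨μ 0, Fin.tail μ, (Fin.cons_self_tail μ).symm⟩
    obtain ⟨n, ν, rfl⟩ : ∃ n ν', ν = Fin.cons n ν' := ⟨ν 0, Fin.tail ν, (Fin.cons_self_tail ν).symm⟩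
    obtain ⟨S, hS, e⟩ := rowSum_symm k o m a n (rowLen ν 0)
    have e' : edgeWt k o m n * (rowSum k o m a n (rowLen ν 0) * lowerSum k (o + 1) a f μ ν) =
        S * (edgeWt k (o + 1) a (rowLen ν 0) * lowerSum k (o + 1) a f μ ν) := by
      linear_combination lowerSum k (o + 1) a f μ ν * e
    rw [rowLen_cons_zero, lowerSum_cons (by simpa using hf 0), e', map_mul, hS,
      ih (o + 1) a fun i => by simpa using hf i.succ]

/-! ### The action of `π_k` on the first row -/

/-- The sum over all ways to fill the columns `m + 1, …, a` of a first row `i` with entries `k`, up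
to column `κ`, and `k + 1`, including the optional `k + 1` in column `κ`, above a row with `n`
boxes. -/
def topSum (k i m a n : ℕ) : PolyXB :=
  ∑ κ ∈ Finset.Iic a, stripWt k i m κ * stripWt (k + 1) i κ a * cornerWt (k + 1) i κ n

/-- `π_k` turns a first row with `a + 1` boxes and no entry above `k` into one with `a` boxes and
no entry above `k + 1`. -/
theorem dividedDiff_stripWt_mul {k i m a n : ℕ} (hn : n ≤ a) {L : PolyXB}
    (hL : swapX k (edgeWt k i m n * L) = edgeWt k i m n * L) :
    dividedDiff k (stripWt k i m (a + 1) * L) = topSum k i m a n * L := by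
  set b : ℕ → PolyXB := fun c => varB (k + c - (i + 1)) with hbdef
  have hb : ∀ c, swapX k (b c) = b c := fun c => swapX_varB _ _
  have hsum : topSum k i m a n = ∑ κ ∈ Finset.Icc (max m n) a,
      stripWt k i m κ * stripWt (k + 1) i κ a * cornerWt (k + 1) i κ n := by
    refine sum_Iic_eq_sum_Icc le_rfl _ fun κ h1 h2 => ?_
    rcases lt_or_ge κ m with h | h
    · rw [stripWt_of_lt h]; ring
    · rw [cornerWt_of_gt (show κ < n by simp only [max_le_iff] at h1; omega)]; ring
  have hterm : ∀ κ ∈ Finset.Icc (max m n) a,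
      stripWt k i m κ * stripWt (k + 1) i κ a * cornerWt (k + 1) i κ n =
      (∏ c ∈ Finset.Ioc m (max m n), entryWt k i c) *
      (splitProd (varX k) (varX (k + 1)) b (max m n) κ a *
        (if n < κ then 1 + betaVar * oplus (varX (k + 1)) (b (κ + 1)) else 1)) := by
    intro κ hκ
    rw [Finset.mem_Icc] at hκ
    rw [strip_mul_strip (le_max_left _ _) hκ.1 hκ.2 le_rfl,
      cornerWt_of_le ((le_max_right _ _).trans hκ.1), entryWt_succ]
    simp only [Finset.Ioc_self, Finset.prod_empty]
    ring
  rw [hsum, Finset.sum_congr rfl hterm, ← Finset.mul_sum]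
  clear hsum hterm
  -- for `n < m` the polynomial `L` is not symmetric, but `(1 + β x_{k+1}) L` is
  rcases lt_or_ge n m with h | h
  · rw [edgeWt, if_pos h, map_mul] at hL
    simp only [map_add, map_mul, map_one, swapX_betaVar, swapX_varX_right] at hL
    rw [max_eq_left h.le]
    rcases lt_or_ge a m with ha | ha
    · rw [Finset.Icc_eq_empty (by omega), Finset.sum_empty, mul_zero, zero_mul]
      rcases Nat.lt_or_ge (a + 1) m with ha' | ha'
      · rw [stripWt_of_lt ha', zero_mul, dividedDiff_zero]
      · obtain rfl : m = a + 1 := by omega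
        rw [stripWt_self, one_mul]
        apply dividedDiff_unique
        linear_combination hL
    · have e : ∀ κ ∈ Finset.Icc m a, splitProd (varX k) (varX (k + 1)) b m κ a *
          (if n < κ then 1 + betaVar * oplus (varX (k + 1)) (b (κ + 1)) else 1) =
          splitProd (varX k) (varX (k + 1)) b m κ a *
            (1 + betaVar * oplus (varX (k + 1)) (b (κ + 1))) := by
        intro κ hκ
        rw [Finset.mem_Icc] at hκ
        rw [if_pos (by omega)]
      rw [Finset.sum_congr rfl e, sum_splitProd_mark, stripWt_of_le (show m ≤ a + 1 by omega)]
      apply dividedDiff_unique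
      rw [map_mul, swapX_runProd hb, Finset.Ioc_self, Finset.prod_empty]
      linear_combination (1 + betaVar * varX (k + 1)) * L *
        sub_mul_splitSum (varX k) (varX (k + 1)) b ha +
          runProd (varX (k + 1)) b m (a + 1) * hL
  · rw [edgeWt, if_neg (by omega)] at hL
    rw [max_eq_right h, sum_splitProd_mark_of_lt hb hn, stripWt_of_le (by omega),
      ← runProd_mul _ _ h (show n ≤ a + 1 by omega)]
    have e : runProd (varX k) b m n * runProd (varX k) b n (a + 1) * L =
        ((∏ c ∈ Finset.Ioc m n, entryWt k i c) * L) * runProd (varX k) b n (a + 1) := by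
      rw [show (∏ c ∈ Finset.Ioc m n, entryWt k i c) = runProd (varX k) b m n from rfl]
      ring
    rw [e, dividedDiff_mul_of_symm hL]
    ring

theorem topSum_eq_zero {k i m a n : ℕ} (h : a < m) : topSum k i m a n = 0 := by
  refine Finset.sum_eq_zero fun κ hκ => ?_
  rw [Finset.mem_Iic] at hκ
  rw [stripWt_of_lt (by omega), zero_mul, zero_mul]

theorem swapX_chainSum {k o r t : ℕ} (h : o + t < k) (f ν : Fin r → ℕ) :
    swapX k (chainSum o f t ν) = chainSum o f t ν := by
  induction t generalizing ν with
  | zero =>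
    simp only [chainSum]
    split_ifs <;> simp
  | succ t ih =>
    simp only [chainSum, map_sum, map_mul]
    refine Finset.sum_congr rfl fun μ _ => ?_
    rw [ih (by omega), swapX_transferWt (by omega) (by omega)]

/-- Flags beyond the largest value in use are immaterial. -/
theorem chainSum_flag_congr {k k' o r t : ℕ} (h : o + t ≤ k) (h' : o + t ≤ k') (f : Fin r → ℕ)
    (ν : Fin (r + 1) → ℕ) :
    chainSum o (Fin.cons k f : Fin (r + 1) → ℕ) t ν =
      chainSum o (Fin.cons k' f : Fin (r + 1) → ℕ) t ν := by
  induction t generalizing ν with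
  | zero => rfl
  | succ t ih =>
    obtain ⟨n, ν, rfl⟩ : ∃ n ν', ν = Fin.cons n ν' := ⟨ν 0, Fin.tail ν, (Fin.cons_self_tail ν).symm⟩
    rw [chainSum, chainSum, sum_Iic_cons, sum_Iic_cons]
    refine Finset.sum_congr rfl fun m _ => Finset.sum_congr rfl fun μ _ => ?_
    rw [ih (by omega) (by omega), transferWt_cons, transferWt_cons,
      rowWt_of_pos (show o + t + 1 ≤ k by omega), rowWt_of_pos (show o + t + 1 ≤ k' by omega)]

theorem chainSum_add_two (o : ℕ) {r : ℕ} (f : Fin r → ℕ) (s : ℕ) (ν : Fin r → ℕ) :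
    chainSum o f (s + 2) ν = ∑ μ ∈ Finset.Iic ν, chainSum o f s μ *
      ∑ κ ∈ Finset.Iic ν, transferWt (o + s + 1) o f μ κ * transferWt (o + s + 1 + 1) o f κ ν := by
  have e : ∀ κ ∈ Finset.Iic ν, chainSum o f (s + 1) κ * transferWt (o + s + 1 + 1) o f κ ν =
      ∑ μ ∈ Finset.Iic ν, chainSum o f s μ *
        (transferWt (o + s + 1) o f μ κ * transferWt (o + s + 1 + 1) o f κ ν) := by
    intro κ hκ
    rw [chainSum, Finset.sum_mul]
    simp only [← mul_assoc]
    refine Finset.sum_subset (Finset.Iic_subset_Iic.2 (Finset.mem_Iic.1 hκ)) fun μ _ hμ => ?_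
    have h0 : transferWt (o + s + 1) o f μ κ = 0 := by
      by_contra hne
      exact hμ (Finset.mem_Iic.2 (le_of_transferWt_ne_zero hne))
    rw [h0, mul_zero, zero_mul]
  calc chainSum o f (s + 2) ν
      = ∑ κ ∈ Finset.Iic ν, chainSum o f (s + 1) κ * transferWt (o + s + 1 + 1) o f κ ν := rfl
    _ = _ := by
      rw [Finset.sum_congr rfl e, Finset.sum_comm]
      simp only [Finset.mul_sum]

/-- Values beyond the flag of the first row leave the first row alone. -/
theorem chainSum_succ_of_flag_lt {k o r t a : ℕ} (h : k < o + t + 1) (f : Fin r → ℕ)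
    {ν : Fin r → ℕ} (hν : rowLen ν 0 ≤ a) :
    chainSum o (Fin.cons k f : Fin (r + 1) → ℕ) (t + 1) (Fin.cons a ν) =
      ∑ μ ∈ Finset.Iic ν, chainSum o (Fin.cons k f : Fin (r + 1) → ℕ) t (Fin.cons a μ) *
        transferWt (o + t + 1) (o + 1) f μ ν := by
  rw [chainSum, sum_Iic_cons, Finset.sum_eq_single_of_mem a (Finset.mem_Iic.2 le_rfl)]
  · refine Finset.sum_congr rfl fun μ _ => ?_
    rw [transferWt_cons, rowWt_of_neg (by omega), if_pos ⟨rfl, hν⟩, one_mul]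
  · intro m _ hm
    refine Finset.sum_eq_zero fun μ _ => ?_
    rw [transferWt_cons, rowWt_of_neg (by omega), if_neg fun h => hm h.1, zero_mul, mul_zero]

/-- `π_k` removes a box from the first row and raises the flag `k` of this row by one. -/
theorem dividedDiff_chainSum {k o r t a : ℕ} (hk : o + 1 ≤ k) {f : Fin r → ℕ}
    (hf : ∀ i, k + 1 ≤ f i) (ht : k + 1 ≤ o + t) {ν : Fin r → ℕ} (hν : rowLen ν 0 ≤ a) :
    dividedDiff k (chainSum o (Fin.cons k f : Fin (r + 1) → ℕ) t (Fin.cons (a + 1) ν)) =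
      chainSum o (Fin.cons (k + 1) f : Fin (r + 1) → ℕ) t (Fin.cons a ν) := by
  obtain ⟨s, rfl⟩ : ∃ s, k = o + s + 1 := ⟨k - (o + 1), by omega⟩
  obtain ⟨u, rfl⟩ : ∃ u, t = s + 2 + u := ⟨t - (s + 2), by omega⟩
  induction u generalizing ν with
  | zero =>
    set k := o + s + 1 with hkdef
    have hl : ∀ m μ, ∑ κ ∈ Finset.Iic (Fin.cons (a + 1) ν : Fin (r + 1) → ℕ),
        transferWt k o (Fin.cons k f : Fin (r + 1) → ℕ) (Fin.cons m μ) κ *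
          transferWt (k + 1) o (Fin.cons k f : Fin (r + 1) → ℕ) κ (Fin.cons (a + 1) ν) =
        stripWt k o m (a + 1) * lowerSum k o m f μ ν := by
      intro m μ
      rw [sum_Iic_cons, Finset.sum_eq_single_of_mem (a + 1) (Finset.mem_Iic.2 le_rfl)]
      · rw [lowerSum, Finset.mul_sum]
        refine Finset.sum_congr rfl fun κ _ => ?_
        rw [transferWt_cons, transferWt_cons, rowWt_of_pos le_rfl, rowWt_of_neg (by omega),
          if_pos ⟨rfl, by omega⟩]
        ring
      · intro n _ hn
        refine Finset.sum_eq_zero fun κ _ => ?_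
        rw [transferWt_cons, transferWt_cons, rowWt_of_neg (show ¬ k + 1 ≤ k by omega),
          if_neg fun h => hn h.1]
        ring
    have hr : ∀ m μ, ∑ κ ∈ Finset.Iic (Fin.cons a ν : Fin (r + 1) → ℕ),
        transferWt k o (Fin.cons (k + 1) f : Fin (r + 1) → ℕ) (Fin.cons m μ) κ *
          transferWt (k + 1) o (Fin.cons (k + 1) f : Fin (r + 1) → ℕ) κ (Fin.cons a ν) =
        topSum k o m a (rowLen ν 0) * lowerSum k o m f μ ν := by
      intro m μ
      rw [sum_Iic_cons, topSum, lowerSum, Finset.sum_mul_sum]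
      refine Finset.sum_congr rfl fun n _ => Finset.sum_congr rfl fun κ _ => ?_
      rw [transferWt_cons, transferWt_cons, rowWt_of_pos (by omega), rowWt_of_pos (by omega)]
      ring
    rw [add_zero, chainSum_add_two, chainSum_add_two, dividedDiff_sum, sum_Iic_cons, sum_Iic_cons]
    simp only [← hkdef, hl, hr]
    have hsub : Finset.Iic a ⊆ Finset.Iic (a + 1) := Finset.Iic_subset_Iic.2 (Nat.le_succ a)
    symm
    refine Finset.sum_subset_zero_on_sdiff hsub (fun m hm => ?_) fun m _ => ?_
    · rw [Finset.mem_sdiff, Finset.mem_Iic, Finset.mem_Iic] at hm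
      refine Finset.sum_eq_zero fun μ _ => ?_
      rw [dividedDiff_mul_of_symm (swapX_chainSum (by omega) _ _), dividedDiff_stripWt_mul hν
        (swapX_edgeWt_mul_lowerSum o m hf μ ν), topSum_eq_zero (by omega)]
      ring
    · refine Finset.sum_congr rfl fun μ _ => ?_
      rw [dividedDiff_mul_of_symm (swapX_chainSum (by omega) _ _), dividedDiff_stripWt_mul hν
        (swapX_edgeWt_mul_lowerSum o m hf μ ν),
        chainSum_flag_congr (k := k) (k' := k + 1) (by omega) (by omega)]
  | succ u ih =>
    rw [← add_assoc, chainSum_succ_of_flag_lt (by omega) f (by omega),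
      chainSum_succ_of_flag_lt (by omega) f hν, dividedDiff_sum]
    refine Finset.sum_congr rfl fun μ hμ => ?_
    rw [mul_comm, dividedDiff_mul_of_symm (swapX_transferWt (by omega) (by omega) _ _ _),
      ih ((rowLen_mono (Finset.mem_Iic.1 hμ) 0).trans hν) (by omega), mul_comm]

theorem dividedDiffWord_Ico_chainSum {k o r t : ℕ} (hk : o + 1 ≤ k) {f : Fin r → ℕ} (d : ℕ)
    (hf : ∀ i, k + d ≤ f i) (ht : k + d ≤ o + t) {a : ℕ} {ν : Fin r → ℕ} (hν : rowLen ν 0 ≤ a) :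
    dividedDiffWord (List.Ico k (k + d))
        (chainSum o (Fin.cons k f : Fin (r + 1) → ℕ) t (Fin.cons (a + d) ν)) =
      chainSum o (Fin.cons (k + d) f : Fin (r + 1) → ℕ) t (Fin.cons a ν) := by
  induction d generalizing a with
  | zero => simp [dividedDiffWord]
  | succ d ih =>
    rw [← add_assoc k, List.Ico.succ_top (by omega), dividedDiffWord_append,
      show a + (d + 1) = a + 1 + d by omega,
      ih (hf := fun i => by have := hf i; omega) (ht := by omega) (hν := by omega)]
    exact dividedDiff_chainSum (k := k + d) (by omega) hf ht hν

/-- A first row with flag `o + 1` can only hold the entries `o + 1`. -/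
theorem chainSum_cons_first {o r : ℕ} (t : ℕ) (f : Fin r → ℕ) {a : ℕ} {ν : Fin r → ℕ}
    (hν : rowLen ν 0 ≤ a) :
    chainSum o (Fin.cons (o + 1) f : Fin (r + 1) → ℕ) (t + 1) (Fin.cons a ν) =
      (∏ c ∈ Finset.Ioc 0 a, entryWt (o + 1) o c) * chainSum (o + 1) f t ν := by
  induction t generalizing ν with
  | zero =>
    have hz : ∀ μ : Fin (r + 1) → ℕ, μ ∈ Finset.Iic (Fin.cons a ν : Fin (r + 1) → ℕ) → μ ≠ 0 →
        chainSum o (Fin.cons (o + 1) f : Fin (r + 1) → ℕ) 0 μ *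
          transferWt (o + 0 + 1) o (Fin.cons (o + 1) f : Fin (r + 1) → ℕ) μ (Fin.cons a ν) = 0 := by
      intro μ _ hμ
      rw [chainSum, if_neg hμ, zero_mul]
    have e0 : (0 : Fin (r + 1) → ℕ) = Fin.cons 0 (0 : Fin r → ℕ) := by
      ext i
      refine Fin.cases rfl (fun j => rfl) i
    rw [chainSum_succ, Finset.sum_eq_single_of_mem 0 (Finset.mem_Iic.2 fun i => Nat.zero_le _) hz,
      chainSum_zero, chainSum_zero, if_pos rfl, one_mul, add_zero]
    split_ifs with h
    · subst h
      have hr : ∀ j, rowLen (0 : Fin r → ℕ) j = 0 := fun j => by simp [rowLen]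
      have h1 : transferWt (o + 1) (o + 1) f 0 0 = 1 := by
        refine Finset.prod_eq_one fun i _ => ?_
        rw [rowWt, hr]
        simp only [Pi.zero_apply, stripWt_self, cornerWt, lt_irrefl, if_false, if_true, mul_one,
          le_refl, and_self, ite_self]
      rw [e0, transferWt_cons, rowWt_of_pos le_rfl, hr, cornerWt_of_le le_rfl,
        if_neg (lt_irrefl _), stripWt, if_pos (Nat.zero_le a), mul_one, h1, mul_one]
    · obtain ⟨i, hi⟩ := Function.ne_iff.1 h
      rw [mul_zero]
      refine transferWt_eq_zero i.castSucc fun hc => hi ?_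
      have := hc.2
      rw [Fin.val_castSucc, rowLen_cons_succ, rowLen_apply] at this
      exact Nat.le_zero.1 this
  | succ t ih =>
    rw [chainSum_succ_of_flag_lt (by omega) f hν, chainSum, Finset.mul_sum]
    refine Finset.sum_congr rfl fun μ hμ => ?_
    rw [ih ((rowLen_mono (Finset.mem_Iic.1 hμ) 0).trans hν), mul_assoc,
      show o + (t + 1) + 1 = o + 1 + t + 1 by omega]

theorem dividedDiffWord_mul_of_symm {ω : List ℕ} {h : PolyXB} (hs : ∀ i ∈ ω, swapX i h = h)
    (g : PolyXB) : dividedDiffWord ω (h * g) = h * dividedDiffWord ω g := by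
  induction ω using List.reverseRecOn with
  | nil => rfl
  | append_singleton p i ih =>
    rw [dividedDiffWord_append, dividedDiffWord_append, ih fun j hj => hs j (by simp [hj])]
    exact dividedDiff_mul_of_symm (hs i (by simp)) _

/-- The generating function built up value by value is obtained from a product of linear factors
by the operators of `flagBlocks`. -/
theorem chainSum_eq_dividedDiffWord {r : ℕ} (o t : ℕ) {lam f : Fin r → ℕ} (hlam : Antitone lam)
    (hmono : Monotone f) (hf : ∀ i : Fin r, o + (i : ℕ) + 1 ≤ f i) (ht : ∀ i, f i ≤ o + t) :
    chainSum o f t lam = dividedDiffWord (flagBlocks o f)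
      (∏ i : Fin r, ∏ j ∈ Finset.Icc 1 (lam i + f i - (o + (i : ℕ) + 1)),
        oplus (varX (o + (i : ℕ) + 1)) (varB j)) := by
  induction r generalizing o t with
  | zero =>
    have e : ∀ t ν, chainSum o f t ν = 1 := by
      intro t
      induction t with
      | zero => intro ν; rw [chainSum, if_pos (Subsingleton.elim _ _)]
      | succ t ih =>
        intro ν
        rw [chainSum, Iic_fin_zero, Finset.sum_singleton, ih, transferWt, one_mul]
        rfl
    rw [e]
    rfl
  | succ r ih =>
    obtain ⟨k, f, rfl⟩ : ∃ k f', f = Fin.cons k f' := ⟨f 0, Fin.tail f, (Fin.cons_self_tail f).symm⟩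
    obtain ⟨a, lam, rfl⟩ : ∃ a l, lam = Fin.cons a l :=
      ⟨lam 0, Fin.tail lam, (Fin.cons_self_tail lam).symm⟩
    have hk : o + 1 ≤ k := by simpa using hf 0
    have hkt : k ≤ o + t := by simpa using ht 0
    obtain ⟨d, rfl⟩ : ∃ d, k = o + 1 + d := ⟨k - (o + 1), by omega⟩
    obtain ⟨t, rfl⟩ : ∃ u, t = u + 1 := ⟨t - 1, by omega⟩
    have hν : rowLen lam 0 ≤ a := by
      rw [rowLen]
      split_ifs
      · simpa using hlam (Fin.zero_le (Fin.succ ⟨0, ‹_›⟩))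
      · exact Nat.zero_le _
    have hfk : ∀ i, o + 1 + d ≤ f i := fun i => by simpa using hmono (Fin.zero_le i.succ)
    have ih' := ih (o + 1) t (lam := lam) (f := f)
      (fun i j hij => by simpa using hlam (Fin.succ_le_succ_iff.2 hij))
      (fun i j hij => by simpa using hmono (Fin.succ_le_succ_iff.2 hij))
      (fun i => by have := hf i.succ; simp only [Fin.cons_succ, Fin.val_succ] at this; omega)
      (fun i => by have := ht i.succ; simp only [Fin.cons_succ] at this; omega)
    rw [flagBlocks_cons, dividedDiffWord_append, Fin.prod_univ_succ,
      ← dividedDiffWord_Ico_chainSum le_rfl d hfk hkt hν, chainSum_cons_first t f (by omega), ih',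
      dividedDiffWord_mul_of_symm (ω := flagBlocks (o + 1) f)]
    · refine congrArg _ (congrArg₂ (· * ·) ?_ (congrArg _ ?_))
      · simp only [Fin.cons_zero, Fin.val_zero, add_zero]
        rw [show a + (o + 1 + d) - (o + 1) = a + d by omega]
        refine Finset.prod_congr (by ext; simp [Nat.succ_le_iff]) fun c _ => ?_
        rw [entryWt, Nat.add_sub_cancel_left]
      · refine Finset.prod_congr rfl fun i _ => ?_
        simp only [Fin.cons_succ, Fin.val_succ]
        rw [show o + ((i : ℕ) + 1) + 1 = o + 1 + i + 1 by omega]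
    · intro i hi
      have := le_of_mem_flagBlocks hi
      simp only [Fin.cons_zero, Fin.val_zero, add_zero, map_prod, swapX_oplus, swapX_varB]
      rw [swapX_varX_of_ne (by omega) (by omega)]

/-! ### Tableaux as sets of entries -/

/-- The sets of entries of the set-valued tableaux of shape `ν` with flags `f` and values at most
`n`; the triple `(i, c, v)` stands for an entry `v` in row `i` (counted from `0`) and column `c`
(counted from `1`). -/
structure IsEntrySet {r : ℕ} (f : Fin r → ℕ) (n : ℕ) (ν : Fin r → ℕ)
    (E : Finset (Fin r × ℕ × ℕ)) : Prop where
  bound : ∀ {i c v}, (i, c, v) ∈ E → 1 ≤ c ∧ c ≤ ν i ∧ 1 ≤ v ∧ v ≤ n ∧ v ≤ f i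
  cover : ∀ {i c}, 1 ≤ c → c ≤ ν i → ∃ v, (i, c, v) ∈ E
  row : ∀ {i c v v'}, (i, c, v) ∈ E → (i, c + 1, v') ∈ E → v ≤ v'
  col : ∀ {i j : Fin r} {c v v'}, (j : ℕ) = i + 1 → (i, c, v) ∈ E → (j, c, v') ∈ E → v < v'

open Classical in
/-- The finite set of the sets of entries described by `IsEntrySet`. -/
def entrySets {r : ℕ} (f : Fin r → ℕ) (n : ℕ) (ν : Fin r → ℕ) :
    Finset (Finset (Fin r × ℕ × ℕ)) :=
  (Finset.univ ×ˢ Finset.Icc 1 (Finset.univ.sup ν) ×ˢ Finset.Icc 1 n).powerset.filter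
    (IsEntrySet f n ν)

theorem mem_entrySets {r : ℕ} {f : Fin r → ℕ} {n : ℕ} {ν : Fin r → ℕ}
    {E : Finset (Fin r × ℕ × ℕ)} : E ∈ entrySets f n ν ↔ IsEntrySet f n ν E := by
  classical
  rw [entrySets, Finset.mem_filter, and_iff_right_iff_imp, Finset.mem_powerset]
  rintro h ⟨i, c, v⟩ he
  have := h.bound he
  have := Finset.le_sup (f := ν) (Finset.mem_univ i)
  simp only [Finset.mem_product, Finset.mem_univ, Finset.mem_Icc, true_and]
  omega

/-- The product of the weights of the entries. -/
def entryProd {r : ℕ} (E : Finset (Fin r × ℕ × ℕ)) : PolyXB :=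
  ∏ e ∈ E, entryWt e.2.2 e.1 e.2.1

/-- The generating function of the sets of entries described by `IsEntrySet`. -/
def entrySum {r : ℕ} (f : Fin r → ℕ) (n : ℕ) (ν : Fin r → ℕ) : PolyXB :=
  ∑ E ∈ entrySets f n ν, betaVar ^ (E.card - ∑ i, ν i) * entryProd E

theorem IsEntrySet.sum_le_card {r : ℕ} {f : Fin r → ℕ} {n : ℕ} {ν : Fin r → ℕ}
    {E : Finset (Fin r × ℕ × ℕ)} (h : IsEntrySet f n ν E) : ∑ i, ν i ≤ E.card := by
  have hsub : (Finset.univ.sigma fun i => Finset.Icc 1 (ν i)) ⊆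
      E.image fun e => (⟨e.1, e.2.1⟩ : (_ : Fin r) × ℕ) := by
    rintro ⟨i, c⟩ hc
    rw [Finset.mem_sigma, Finset.mem_Icc] at hc
    obtain ⟨v, hv⟩ := h.cover hc.2.1 hc.2.2
    exact Finset.mem_image.2 ⟨_, hv, rfl⟩
  have := (Finset.card_le_card hsub).trans Finset.card_image_le
  simpa [Finset.card_sigma] using this

/-- The boxes of `ν` outside `κ`, each with the entry `v`. -/
def stripEntries {r : ℕ} (v : ℕ) (κ ν : Fin r → ℕ) : Finset (Fin r × ℕ × ℕ) :=
  (Finset.univ.sigma fun i => Finset.Ioc (κ i) (ν i)).image fun p => (p.1, p.2, v)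

/-- The last boxes of the rows in `M`, each with the entry `v`. -/
def cornerEntries {r : ℕ} (v : ℕ) (κ : Fin r → ℕ) (M : Finset (Fin r)) :
    Finset (Fin r × ℕ × ℕ) :=
  M.image fun i => (i, κ i, v)

theorem mem_stripEntries {r v : ℕ} {κ ν : Fin r → ℕ} {i : Fin r} {c w : ℕ} :
    (i, c, w) ∈ stripEntries v κ ν ↔ κ i < c ∧ c ≤ ν i ∧ w = v := by
  simp only [stripEntries, Finset.mem_image, Finset.mem_sigma, Finset.mem_univ, true_and,
    Finset.mem_Ioc, Prod.mk.injEq]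
  constructor
  · rintro ⟨⟨j, d⟩, h, rfl, rfl, rfl⟩
    exact ⟨h.1, h.2, rfl⟩
  · rintro ⟨h1, h2, rfl⟩
    exact ⟨⟨i, c⟩, ⟨h1, h2⟩, rfl, rfl, rfl⟩

theorem mem_cornerEntries {r v : ℕ} {κ : Fin r → ℕ} {M : Finset (Fin r)} {i : Fin r} {c w : ℕ} :
    (i, c, w) ∈ cornerEntries v κ M ↔ i ∈ M ∧ c = κ i ∧ w = v := by
  simp only [cornerEntries, Finset.mem_image, Prod.mk.injEq]
  constructor
  · rintro ⟨j, h, rfl, rfl, rfl⟩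
    exact ⟨h, rfl, rfl⟩
  · rintro ⟨h1, rfl, rfl⟩
    exact ⟨i, h1, rfl, rfl, rfl⟩

theorem entryProd_stripEntries {r : ℕ} (v : ℕ) (κ ν : Fin r → ℕ) :
    entryProd (stripEntries v κ ν) = ∏ i, ∏ c ∈ Finset.Ioc (κ i) (ν i), entryWt v i c := by
  rw [entryProd, stripEntries, Finset.prod_image, Finset.prod_sigma]
  rintro ⟨i, c⟩ _ ⟨j, d⟩ _ h
  simp only [Prod.mk.injEq, and_true] at h
  obtain ⟨rfl, rfl⟩ := h
  rfl

theorem card_stripEntries {r : ℕ} (v : ℕ) (κ ν : Fin r → ℕ) :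
    (stripEntries v κ ν).card = ∑ i, (ν i - κ i) := by
  rw [stripEntries, Finset.card_image_of_injective, Finset.card_sigma]
  · simp
  · rintro ⟨i, c⟩ ⟨j, d⟩ h
    simp only [Prod.mk.injEq, and_true] at h
    obtain ⟨rfl, rfl⟩ := h
    rfl

theorem cornerEntries_injective {r : ℕ} (v : ℕ) (κ : Fin r → ℕ) :
    Function.Injective fun i : Fin r => (i, κ i, v) :=
  fun _ _ h => (Prod.mk.inj h).1

theorem entryProd_cornerEntries {r : ℕ} (v : ℕ) (κ : Fin r → ℕ) (M : Finset (Fin r)) :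
    entryProd (cornerEntries v κ M) = ∏ i ∈ M, entryWt v i (κ i) := by
  rw [entryProd, cornerEntries, Finset.prod_image (cornerEntries_injective v κ).injOn]

theorem card_cornerEntries {r : ℕ} (v : ℕ) (κ : Fin r → ℕ) (M : Finset (Fin r)) :
    (cornerEntries v κ M).card = M.card :=
  Finset.card_image_of_injective _ (cornerEntries_injective v κ)

/-! ### Removing the largest value -/

/-- The shapes `κ ⊆ ν` that can be the boxes with an entry below `v` in a tableau of shape `ν`
with values at most `v`: the quotient `ν / κ` is a horizontal strip in the rows that admit `v`. -/
def IsStrip {r : ℕ} (f : Fin r → ℕ) (v : ℕ) (κ ν : Fin r → ℕ) : Prop :=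
  ∀ i : Fin r, κ i ≤ ν i ∧ rowLen ν (i + 1) ≤ κ i ∧ (v ≤ f i ∨ κ i = ν i)

/-- The rows whose last box in `κ` may hold an additional entry `v`. -/
def cornerRows {r : ℕ} (f : Fin r → ℕ) (v : ℕ) (κ ν : Fin r → ℕ) : Finset (Fin r) :=
  Finset.univ.filter fun i => v ≤ f i ∧ rowLen ν (i + 1) < κ i

theorem transferWt_eq_sum {r : ℕ} {f : Fin r → ℕ} {v : ℕ} {κ ν : Fin r → ℕ}
    (h : IsStrip f v κ ν) :
    transferWt v 0 f κ ν = ∑ M ∈ (cornerRows f v κ ν).powerset,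
      betaVar ^ M.card * (entryProd (stripEntries v κ ν) * entryProd (cornerEntries v κ M)) := by
  have e : ∀ i : Fin r, rowWt v (v ≤ f i) (0 + i) (κ i) (ν i) (rowLen ν (i + 1)) =
      (∏ c ∈ Finset.Ioc (κ i) (ν i), entryWt v i c) *
        if v ≤ f i ∧ rowLen ν (i + 1) < κ i then 1 + betaVar * entryWt v i (κ i) else 1 := by
    intro i
    obtain ⟨h1, h2, h3⟩ := h i
    rw [zero_add]
    by_cases hv : v ≤ f i
    · rw [rowWt_of_pos hv, stripWt, if_pos h1, cornerWt_of_le h2]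
      simp only [hv, true_and]
    · rw [rowWt_of_neg hv, h3.resolve_left hv, if_pos ⟨rfl, (h3.resolve_left hv) ▸ h2⟩]
      simp [hv]
  rw [transferWt, Finset.prod_congr rfl fun i _ => e i, Finset.prod_mul_distrib,
    ← Finset.prod_filter, Finset.prod_one_add, Finset.mul_sum]
  refine Finset.sum_congr rfl fun M _ => ?_
  rw [entryProd_stripEntries, entryProd_cornerEntries, Finset.prod_mul_distrib,
    Finset.prod_const]
  ring

theorem transferWt_eq_zero_of_not_isStrip {r : ℕ} {f : Fin r → ℕ} {v : ℕ} {κ ν : Fin r → ℕ}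
    (h : ¬ IsStrip f v κ ν) : transferWt v 0 f κ ν = 0 := by
  obtain ⟨i, hi⟩ := not_forall.1 h
  refine Finset.prod_eq_zero (Finset.mem_univ i) ?_
  by_cases hle : κ i ≤ ν i ∧ rowLen ν (i + 1) ≤ κ i
  · rw [rowWt_of_neg fun hv => hi ⟨hle.1, hle.2, Or.inl hv⟩,
      if_neg fun h => hi ⟨hle.1, hle.2, Or.inr h.1⟩]
  · exact rowWt_eq_zero hle

/-- The shape formed by the boxes with an entry at most `n`. -/
def lowShape {r : ℕ} (n : ℕ) (ν : Fin r → ℕ) (E : Finset (Fin r × ℕ × ℕ)) : Fin r → ℕ :=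
  fun i => Nat.findGreatest (fun c => ∃ v ≤ n, (i, c, v) ∈ E) (ν i)

theorem lowShape_le {r : ℕ} (n : ℕ) (ν : Fin r → ℕ) (E : Finset (Fin r × ℕ × ℕ)) (i : Fin r) :
    lowShape n ν E i ≤ ν i :=
  Nat.findGreatest_le _

namespace IsEntrySet

variable {r n : ℕ} {f ν : Fin r → ℕ} {E : Finset (Fin r × ℕ × ℕ)}

theorem le_lowShape (h : IsEntrySet f (n + 1) ν E) {i : Fin r} {c v : ℕ} (hv : v ≤ n)
    (he : (i, c, v) ∈ E) : c ≤ lowShape n ν E i := by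
  unfold lowShape
  exact Nat.le_findGreatest (h.bound he).2.1 ⟨v, hv, he⟩

theorem exists_of_le_lowShape (h : IsEntrySet f (n + 1) ν E) {i : Fin r} {c : ℕ} (hc : 1 ≤ c)
    (hle : c ≤ lowShape n ν E i) : ∃ v ≤ n, (i, c, v) ∈ E := by
  have htop : ∃ v ≤ n, (i, lowShape n ν E i, v) ∈ E := by
    have h0 : lowShape n ν E i ≠ 0 := by omega
    unfold lowShape at h0 ⊢
    exact Nat.findGreatest_of_ne_zero (P := fun c => ∃ v ≤ n, (i, c, v) ∈ E) rfl h0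
  -- the boxes with an entry at most `n` are closed under passing to the left neighbour
  refine Nat.decreasingInduction' (P := fun c => ∃ v ≤ n, (i, c, v) ∈ E)
    (fun d hd hcd ih => ?_) hle htop
  obtain ⟨v, hv, he⟩ := ih
  have := lowShape_le n ν E i
  obtain ⟨w, hw⟩ := h.cover (i := i) (hc.trans hcd) (by omega)
  exact ⟨w, (h.row hw he).trans hv, hw⟩

theorem isStrip_lowShape (hν : ∀ i : Fin r, rowLen ν (i + 1) ≤ ν i)
    (h : IsEntrySet f (n + 1) ν E) : IsStrip f (n + 1) (lowShape n ν E) ν := by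
  intro i
  refine ⟨lowShape_le n ν E i, ?_, ?_⟩
  · rcases Nat.eq_zero_or_pos (rowLen ν (i + 1)) with h0 | hpos
    · omega
    · have hi : (i : ℕ) + 1 < r := by
        by_contra hi
        rw [rowLen, dif_neg hi] at hpos
        omega
      have e : rowLen ν (i + 1) = ν ⟨i + 1, hi⟩ := dif_pos hi
      obtain ⟨v', hv'⟩ := h.cover (i := ⟨i + 1, hi⟩) hpos e.le
      obtain ⟨v, hv⟩ := h.cover (i := i) hpos (hν i)
      have := h.col rfl hv hv'
      have := (h.bound hv').2.2.2.1
      exact h.le_lowShape (by omega) hv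
  · by_contra! hc
    have := lowShape_le n ν E i
    obtain ⟨v, hv⟩ := h.cover (i := i) (c := ν i) (by omega) le_rfl
    have hb := h.bound hv
    have := h.le_lowShape (v := v) (by omega) hv
    omega

theorem filter (h : IsEntrySet f (n + 1) ν E) :
    IsEntrySet f n (lowShape n ν E) (E.filter fun e => e.2.2 ≤ n) where
  bound he := by
    rw [Finset.mem_filter] at he
    have := h.bound he.1
    exact ⟨this.1, h.le_lowShape he.2 he.1, this.2.2.1, he.2, this.2.2.2.2⟩
  cover h1 h2 := by
    obtain ⟨v, hv, he⟩ := h.exists_of_le_lowShape h1 h2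
    exact ⟨v, Finset.mem_filter.2 ⟨he, hv⟩⟩
  row h1 h2 := h.row (Finset.mem_filter.1 h1).1 (Finset.mem_filter.1 h2).1
  col hij h1 h2 := h.col hij (Finset.mem_filter.1 h1).1 (Finset.mem_filter.1 h2).1

theorem lowShape_mem_cornerRows (h : IsEntrySet f (n + 1) ν E) {i : Fin r}
    (he : (i, lowShape n ν E i, n + 1) ∈ E) :
    i ∈ cornerRows f (n + 1) (lowShape n ν E) ν := by
  have hb := h.bound he
  refine Finset.mem_filter.2 ⟨Finset.mem_univ i, hb.2.2.2.2, ?_⟩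
  by_contra! hle
  have hi : (i : ℕ) + 1 < r := by
    by_contra hi
    rw [rowLen, dif_neg hi] at hle
    omega
  have e : rowLen ν (i + 1) = ν ⟨i + 1, hi⟩ := dif_pos hi
  obtain ⟨v', hv'⟩ := h.cover (i := ⟨i + 1, hi⟩) hb.1 (e ▸ hle)
  have := h.col rfl he hv'
  have := (h.bound hv').2.2.2.1
  omega

theorem mem_top_iff (h : IsEntrySet f (n + 1) ν E) {i : Fin r} {c : ℕ} :
    (i, c, n + 1) ∈ E ↔ (lowShape n ν E i < c ∧ c ≤ ν i) ∨
      ((i, lowShape n ν E i, n + 1) ∈ E ∧ c = lowShape n ν E i) := by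
  constructor
  · intro he
    rcases lt_trichotomy c (lowShape n ν E i) with hlt | rfl | hlt
    · obtain ⟨v, hv, he'⟩ := h.exists_of_le_lowShape (Nat.succ_le_succ (Nat.zero_le c)) hlt
      have := h.row he he'
      omega
    · exact Or.inr ⟨he, rfl⟩
    · exact Or.inl ⟨hlt, (h.bound he).2.1⟩
  · rintro (⟨h1, h2⟩ | ⟨he, rfl⟩)
    · obtain ⟨v, hv⟩ := h.cover (i := i) (c := c) (by omega) h2
      rcases (h.bound hv).2.2.2.1.lt_or_eq with hlt | rfl
      · have := h.le_lowShape (Nat.lt_succ_iff.1 hlt) hv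
        omega
      · exact hv
    · exact he

variable {κ : Fin r → ℕ} {M : Finset (Fin r)}

theorem mem_extend (h : IsEntrySet f n κ E) {i : Fin r} {c v : ℕ} :
    (i, c, v) ∈ E ∪ (stripEntries (n + 1) κ ν ∪ cornerEntries (n + 1) κ M) ↔
      (v ≤ n ∧ (i, c, v) ∈ E) ∨
        (v = n + 1 ∧ ((κ i < c ∧ c ≤ ν i) ∨ (i ∈ M ∧ c = κ i))) := by
  simp only [Finset.mem_union, mem_stripEntries, mem_cornerEntries]
  have : (i, c, v) ∈ E → v ≤ n := fun he => (h.bound he).2.2.2.1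
  tauto

/-- A horizontal strip and additional entries in corners extend a tableau by the value `n + 1`. -/
theorem extend (h : IsEntrySet f n κ E) (hs : IsStrip f (n + 1) κ ν)
    (hM : M ⊆ cornerRows f (n + 1) κ ν) :
    IsEntrySet f (n + 1) ν
      (E ∪ (stripEntries (n + 1) κ ν ∪ cornerEntries (n + 1) κ M)) where
  bound {i c v} he := by
    obtain ⟨h1, h2, h3⟩ := hs i
    rcases h.mem_extend.1 he with ⟨_, he⟩ | ⟨rfl, ⟨h4, h5⟩ | ⟨h4, rfl⟩⟩
    · have := h.bound he
      omega
    · omega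
    · have := (Finset.mem_filter.1 (hM h4)).2
      omega
  cover {i c} h1 h2 := by
    rcases le_or_gt c (κ i) with hc | hc
    · obtain ⟨v, hv⟩ := h.cover h1 hc
      exact ⟨v, h.mem_extend.2 (Or.inl ⟨(h.bound hv).2.2.2.1, hv⟩)⟩
    · exact ⟨n + 1, h.mem_extend.2 (Or.inr ⟨rfl, Or.inl ⟨hc, h2⟩⟩)⟩
  row {i c v v'} he he' := by
    rcases h.mem_extend.1 he' with ⟨_, he'⟩ | ⟨rfl, _⟩
    · have hb' := h.bound he'
      rcases h.mem_extend.1 he with ⟨_, he⟩ | ⟨rfl, h4 | h4⟩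
      · exact h.row he he'
      · omega
      · omega
    · rcases h.mem_extend.1 he with ⟨_, he⟩ | ⟨rfl, _⟩
      · omega
      · exact le_rfl
  col {i j c v v'} hij he he' := by
    have hrow : rowLen ν (i + 1) = ν j := by rw [← hij, rowLen_apply]
    have hc : c ≤ ν j := by
      have := (hs j).1
      rcases h.mem_extend.1 he' with ⟨_, he'⟩ | ⟨rfl, h4 | h4⟩
      · have := h.bound he'
        omega
      · omega
      · omega
    obtain ⟨h1, h2, h3⟩ := hs i
    rcases h.mem_extend.1 he with ⟨hv, he⟩ | ⟨rfl, h4 | ⟨h4, rfl⟩⟩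
    · rcases h.mem_extend.1 he' with ⟨_, he'⟩ | ⟨rfl, _⟩
      · exact h.col hij he he'
      · omega
    · omega
    · have := (Finset.mem_filter.1 (hM h4)).2
      omega

theorem lowShape_extend (h : IsEntrySet f n κ E) (hs : IsStrip f (n + 1) κ ν)
    (hM : M ⊆ cornerRows f (n + 1) κ ν) :
    lowShape n ν (E ∪ (stripEntries (n + 1) κ ν ∪ cornerEntries (n + 1) κ M)) = κ := by
  have h' := h.extend hs hM
  ext i
  apply le_antisymm
  · rcases Nat.eq_zero_or_pos (lowShape n ν
      (E ∪ (stripEntries (n + 1) κ ν ∪ cornerEntries (n + 1) κ M)) i) with h0 | hpos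
    · omega
    · obtain ⟨v, hv, he⟩ := h'.exists_of_le_lowShape hpos le_rfl
      rcases h.mem_extend.1 he with ⟨_, he⟩ | ⟨rfl, _⟩
      · exact (h.bound he).2.1
      · omega
  · rcases Nat.eq_zero_or_pos (κ i) with h0 | hpos
    · omega
    · obtain ⟨v, hv⟩ := h.cover hpos le_rfl
      have hvn := (h.bound hv).2.2.2.1
      exact h'.le_lowShape hvn (h.mem_extend.2 (Or.inl ⟨hvn, hv⟩))

theorem filter_extend (h : IsEntrySet f n κ E) :
    (E ∪ (stripEntries (n + 1) κ ν ∪ cornerEntries (n + 1) κ M)).filter (fun e => e.2.2 ≤ n) =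
      E := by
  ext ⟨i, c, v⟩
  rw [Finset.mem_filter, h.mem_extend]
  constructor
  · rintro ⟨⟨_, he⟩ | ⟨rfl, _⟩, hv⟩
    · exact he
    · simp only at hv
      omega
  · intro he
    have hv := (h.bound he).2.2.2.1
    exact ⟨Or.inl ⟨hv, he⟩, hv⟩

theorem mem_extend_corner (h : IsEntrySet f n κ E) {i : Fin r} :
    (i, κ i, n + 1) ∈ E ∪ (stripEntries (n + 1) κ ν ∪ cornerEntries (n + 1) κ M) ↔ i ∈ M := by
  rw [h.mem_extend]
  constructor
  · rintro (⟨h1, _⟩ | ⟨_, h1 | h1⟩)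
    · omega
    · omega
    · exact h1.1
  · exact fun hi => Or.inr ⟨rfl, Or.inr ⟨hi, rfl⟩⟩

theorem weight_extend (h : IsEntrySet f n κ E) (hs : IsStrip f (n + 1) κ ν) :
    betaVar ^ ((E ∪ (stripEntries (n + 1) κ ν ∪ cornerEntries (n + 1) κ M)).card - ∑ i, ν i) *
        entryProd (E ∪ (stripEntries (n + 1) κ ν ∪ cornerEntries (n + 1) κ M)) =
      (betaVar ^ (E.card - ∑ i, κ i) * entryProd E) *
        (betaVar ^ M.card * (entryProd (stripEntries (n + 1) κ ν) *
          entryProd (cornerEntries (n + 1) κ M))) := by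
  have hd : Disjoint (stripEntries (n + 1) κ ν) (cornerEntries (n + 1) κ M) := by
    rw [Finset.disjoint_left]
    rintro ⟨i, c, v⟩ h1 h2
    rw [mem_stripEntries] at h1
    rw [mem_cornerEntries] at h2
    omega
  have hd' : Disjoint E (stripEntries (n + 1) κ ν ∪ cornerEntries (n + 1) κ M) := by
    rw [Finset.disjoint_left]
    rintro ⟨i, c, v⟩ h1 h2
    have := (h.bound h1).2.2.2.1
    rw [Finset.mem_union, mem_stripEntries, mem_cornerEntries] at h2
    omega
  have hcard : ∑ i, (ν i - κ i) + ∑ i, κ i = ∑ i, ν i := by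
    rw [← Finset.sum_add_distrib]
    exact Finset.sum_congr rfl fun i _ => Nat.sub_add_cancel (hs i).1
  have hle := h.sum_le_card
  rw [Finset.card_union_of_disjoint hd', Finset.card_union_of_disjoint hd, card_stripEntries,
    card_cornerEntries, show E.card + (∑ i, (ν i - κ i) + M.card) - ∑ i, ν i =
      (E.card - ∑ i, κ i) + M.card by omega, pow_add]
  simp only [entryProd]
  rw [Finset.prod_union hd', Finset.prod_union hd]
  ring

end IsEntrySet

/-- The tableaux of shape `ν` in which the boxes with an entry at most `n` form the shape `κ`. -/
theorem sum_fiber_lowShape {r n : ℕ} {f ν : Fin r → ℕ}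
    (hν : ∀ i : Fin r, rowLen ν (i + 1) ≤ ν i) (κ : Fin r → ℕ) :
    ∑ E ∈ (entrySets f (n + 1) ν).filter (fun E => lowShape n ν E = κ),
        betaVar ^ (E.card - ∑ i, ν i) * entryProd E =
      entrySum f n κ * transferWt (n + 1) 0 f κ ν := by
  classical
  by_cases hs : IsStrip f (n + 1) κ ν
  · rw [transferWt_eq_sum hs, entrySum, Finset.sum_mul_sum, ← Finset.sum_product']
    symm
    refine Finset.sum_bij'
      (fun p _ => p.1 ∪ (stripEntries (n + 1) κ ν ∪ cornerEntries (n + 1) κ p.2))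
      (fun E _ => (E.filter fun e => e.2.2 ≤ n, Finset.univ.filter fun i => (i, κ i, n + 1) ∈ E))
      ?_ ?_ ?_ ?_ ?_
    · rintro ⟨E, M⟩ h
      rw [Finset.mem_product, mem_entrySets, Finset.mem_powerset] at h
      rw [Finset.mem_filter, mem_entrySets]
      exact ⟨h.1.extend hs h.2, h.1.lowShape_extend hs h.2⟩
    · intro E h
      rw [Finset.mem_filter, mem_entrySets] at h
      obtain ⟨h, rfl⟩ := h
      rw [Finset.mem_product, mem_entrySets, Finset.mem_powerset]
      exact ⟨h.filter, fun i hi => h.lowShape_mem_cornerRows (Finset.mem_filter.1 hi).2⟩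
    · rintro ⟨E, M⟩ h
      rw [Finset.mem_product, mem_entrySets, Finset.mem_powerset] at h
      refine Prod.ext h.1.filter_extend ?_
      ext i
      simp only [Finset.mem_filter, Finset.mem_univ, true_and]
      exact h.1.mem_extend_corner
    · intro E h
      rw [Finset.mem_filter, mem_entrySets] at h
      obtain ⟨h, rfl⟩ := h
      ext ⟨i, c, v⟩
      rw [h.filter.mem_extend]
      simp only [Finset.mem_filter, Finset.mem_univ, true_and, ← h.mem_top_iff]
      constructor
      · rintro (⟨_, he, _⟩ | ⟨rfl, he⟩)
        · exact he
        · exact he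
      · intro he
        rcases (h.bound he).2.2.2.1.lt_or_eq with hlt | rfl
        · exact Or.inl ⟨Nat.lt_succ_iff.1 hlt, he, Nat.lt_succ_iff.1 hlt⟩
        · exact Or.inr ⟨rfl, he⟩
    · rintro ⟨E, M⟩ h
      rw [Finset.mem_product, mem_entrySets] at h
      exact (h.1.weight_extend hs).symm
  · rw [transferWt_eq_zero_of_not_isStrip hs, mul_zero]
    refine Finset.sum_eq_zero fun E h => ?_
    rw [Finset.mem_filter, mem_entrySets] at h
    exact absurd (h.2 ▸ h.1.isStrip_lowShape hν) hs

theorem entrySum_succ {r n : ℕ} {f ν : Fin r → ℕ} (hν : ∀ i : Fin r, rowLen ν (i + 1) ≤ ν i) :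
    entrySum f (n + 1) ν =
      ∑ κ ∈ Finset.Iic ν, entrySum f n κ * transferWt (n + 1) 0 f κ ν := by
  rw [entrySum, ← Finset.sum_fiberwise_of_maps_to (g := lowShape n ν) (t := Finset.Iic ν)
    fun E _ => Finset.mem_Iic.2 (lowShape_le n ν E)]
  exact Finset.sum_congr rfl fun κ _ => sum_fiber_lowShape hν κ

theorem entrySum_zero {r : ℕ} (f ν : Fin r → ℕ) : entrySum f 0 ν = if ν = 0 then 1 else 0 := by
  have hE : ∀ E, IsEntrySet f 0 ν E → E = ∅ := by
    intro E h
    refine Finset.eq_empty_of_forall_notMem ?_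
    rintro ⟨i, c, v⟩ he
    have := h.bound he
    omega
  split_ifs with h0
  · have : entrySets f 0 ν = {∅} := by
      ext E
      rw [mem_entrySets, Finset.mem_singleton]
      refine ⟨hE E, ?_⟩
      rintro rfl
      refine ⟨fun h => absurd h (Finset.notMem_empty _), fun h1 h2 => ?_,
        fun h => absurd h (Finset.notMem_empty _), fun _ h => absurd h (Finset.notMem_empty _)⟩
      rw [h0, Pi.zero_apply] at h2
      omega
    rw [entrySum, this, Finset.sum_singleton]
    simp [entryProd]
  · refine Finset.sum_eq_zero fun E h => absurd ?_ h0
    rw [mem_entrySets] at h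
    ext i
    by_contra hi
    obtain ⟨v, hv⟩ := h.cover (i := i) (c := ν i) (Nat.one_le_iff_ne_zero.2 hi) le_rfl
    rw [hE E h] at hv
    exact Finset.notMem_empty _ hv

/-- The generating function of tableaux is the sum over chains of shapes. -/
theorem entrySum_eq_chainSum {r n : ℕ} {f ν : Fin r → ℕ}
    (hν : ∀ i : Fin r, rowLen ν (i + 1) ≤ ν i) : entrySum f n ν = chainSum 0 f n ν := by
  induction n generalizing ν with
  | zero => rw [entrySum_zero, chainSum_zero]
  | succ n ih =>
    rw [entrySum_succ hν, chainSum_succ, zero_add]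
    refine Finset.sum_congr rfl fun κ _ => ?_
    by_cases hs : IsStrip f (n + 1) κ ν
    · rw [ih fun i => ((rowLen_mono (fun j => (hs j).1) (i + 1)).trans (hs i).2.1)]
    · rw [transferWt_eq_zero_of_not_isStrip hs, mul_zero, mul_zero]

/-- The set of entries of a tableau. -/
def toEntries {r : ℕ} {lam : Fin r → ℕ} (T : YBox lam → Finset ℕ) : Finset (Fin r × ℕ × ℕ) :=
  (Finset.univ.sigma T).image fun p => (p.1.1, (p.1.2 : ℕ) + 1, p.2)

theorem mem_toEntries {r : ℕ} {lam : Fin r → ℕ} {T : YBox lam → Finset ℕ} {i : Fin r} {c v : ℕ} :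
    (i, c, v) ∈ toEntries T ↔ ∃ d : Fin (lam i), c = d + 1 ∧ v ∈ T ⟨i, d⟩ := by
  simp only [toEntries, Finset.mem_image, Finset.mem_sigma, Finset.mem_univ, true_and,
    Prod.mk.injEq]
  constructor
  · rintro ⟨⟨⟨j, d⟩, w⟩, h, rfl, rfl, rfl⟩
    exact ⟨d, rfl, h⟩
  · rintro ⟨d, rfl, h⟩
    exact ⟨⟨⟨i, d⟩, v⟩, h, rfl, rfl, rfl⟩

theorem toEntries_injective {r : ℕ} {lam : Fin r → ℕ} :
    Function.Injective fun p : (_ : YBox lam) × ℕ => (p.1.1, (p.1.2 : ℕ) + 1, p.2) := by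
  rintro ⟨⟨i, c⟩, v⟩ ⟨⟨j, d⟩, w⟩ h
  simp only [Prod.mk.injEq, add_left_inj] at h
  obtain ⟨rfl, h, rfl⟩ := h
  obtain rfl := Fin.ext h
  rfl

theorem card_toEntries {r : ℕ} {lam : Fin r → ℕ} (T : YBox lam → Finset ℕ) :
    (toEntries T).card = numEntries T := by
  rw [toEntries, Finset.card_image_of_injective _ toEntries_injective, Finset.card_sigma,
    numEntries]

theorem entryProd_toEntries {r : ℕ} {lam : Fin r → ℕ} (T : YBox lam → Finset ℕ) :
    entryProd (toEntries T) = tabWeight T := by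
  rw [toEntries, entryProd, Finset.prod_image toEntries_injective.injOn, Finset.prod_sigma,
    tabWeight]
  rfl

theorem isEntrySet_toEntries {r n : ℕ} {lam f : Fin r → ℕ} (hn : ∀ i, f i ≤ n)
    {T : YBox lam → Finset ℕ} (h : T ∈ flaggedTableaux lam f) :
    IsEntrySet f n lam (toEntries T) := by
  obtain ⟨hT, hf⟩ := mem_flaggedTableaux.1 h
  refine ⟨fun {i c v} he => ?_, fun {i c} h1 h2 => ?_, fun {i c v v'} he he' => ?_,
    fun {i j c v v'} hij he he' => ?_⟩
  · obtain ⟨d, rfl, hv⟩ := mem_toEntries.1 he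
    have := Finset.mem_Icc.1 (hf _ hv)
    have hni := hn i
    have hd := d.isLt
    simp only at this
    omega
  · obtain ⟨v, hv⟩ := hT.nonempty ⟨i, ⟨c - 1, by omega⟩⟩
    exact ⟨v, mem_toEntries.2 ⟨_, by simp only; omega, hv⟩⟩
  · obtain ⟨d, rfl, hv⟩ := mem_toEntries.1 he
    obtain ⟨d', e, hv'⟩ := mem_toEntries.1 he'
    exact hT.row_weak ⟨i, d⟩ ⟨i, d'⟩ rfl e.symm v hv v' hv'
  · obtain ⟨d, rfl, hv⟩ := mem_toEntries.1 he
    obtain ⟨d', e, hv'⟩ := mem_toEntries.1 he'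
    exact hT.col_strict ⟨i, d⟩ ⟨j, d'⟩ (congrArg (· + 1) hij) e.symm v hv v' hv'

/-- The tableau with a given set of entries. -/
def ofEntries {r : ℕ} (lam : Fin r → ℕ) (E : Finset (Fin r × ℕ × ℕ)) (p : YBox lam) : Finset ℕ :=
  (E.filter fun e => e.1 = p.1 ∧ e.2.1 = (p.2 : ℕ) + 1).image fun e => e.2.2

theorem mem_ofEntries {r : ℕ} {lam : Fin r → ℕ} {E : Finset (Fin r × ℕ × ℕ)} {p : YBox lam}
    {v : ℕ} : v ∈ ofEntries lam E p ↔ (p.1, (p.2 : ℕ) + 1, v) ∈ E := by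
  simp only [ofEntries, Finset.mem_image, Finset.mem_filter]
  constructor
  · rintro ⟨⟨i, c, w⟩, ⟨he, h1, h2⟩, rfl⟩
    simp only at h1 h2
    subst h1 h2
    exact he
  · exact fun he => ⟨_, ⟨he, rfl, rfl⟩, rfl⟩

theorem ofEntries_mem {r n : ℕ} {lam f : Fin r → ℕ} {E : Finset (Fin r × ℕ × ℕ)}
    (h : IsEntrySet f n lam E) : ofEntries lam E ∈ flaggedTableaux lam f := by
  refine mem_flaggedTableaux.2 ⟨⟨fun p => ?_, fun p e he => ?_, fun p q hr hc a ha c hc' => ?_,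
    fun p q hr hc a ha c hc' => ?_⟩, fun p v hv => ?_⟩
  · obtain ⟨v, hv⟩ := h.cover (i := p.1) (c := (p.2 : ℕ) + 1) (by omega) p.2.isLt
    exact ⟨v, mem_ofEntries.2 hv⟩
  · exact (h.bound (mem_ofEntries.1 he)).2.2.1
  · obtain ⟨i, d⟩ := p
    obtain ⟨j, d'⟩ := q
    obtain rfl : j = i := Fin.ext (Nat.succ_injective hr)
    have hc'' := mem_ofEntries.1 hc'
    rw [show (d' : ℕ) + 1 = d + 1 + 1 from hc] at hc''
    exact h.row (mem_ofEntries.1 ha) hc''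
  · have ha' := mem_ofEntries.1 ha
    have hc'' := mem_ofEntries.1 hc'
    rw [show (q.2 : ℕ) + 1 = p.2 + 1 from hc] at hc''
    exact h.col (Nat.succ_injective hr) ha' hc''
  · have := h.bound (mem_ofEntries.1 hv)
    exact Finset.mem_Icc.2 ⟨this.2.2.1, this.2.2.2.2⟩

theorem flaggedGrothendieck_eq_entrySum {r n : ℕ} {lam f : Fin r → ℕ} (hn : ∀ i, f i ≤ n) :
    flaggedGrothendieck lam f = entrySum f n lam := by
  refine Finset.sum_bij' (fun T _ => toEntries T) (fun E _ => ofEntries lam E)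
    (fun T h => mem_entrySets.2 (isEntrySet_toEntries hn h))
    (fun E h => ofEntries_mem (mem_entrySets.1 h)) (fun T _ => ?_) (fun E h => ?_) fun T _ => ?_
  · ext ⟨i, c⟩ v
    rw [mem_ofEntries, mem_toEntries]
    constructor
    · rintro ⟨d, e, hv⟩
      obtain rfl : c = d := Fin.ext (Nat.succ_injective e)
      exact hv
    · exact fun hv => ⟨c, rfl, hv⟩
  · ext ⟨i, c, v⟩
    rw [mem_toEntries]
    constructor
    · rintro ⟨d, rfl, hv⟩
      exact mem_ofEntries.1 hv
    · intro he
      have := (mem_entrySets.1 h).bound he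
      have e : c - 1 + 1 = c := by omega
      refine ⟨⟨c - 1, by omega⟩, e.symm, mem_ofEntries.2 ?_⟩
      simpa only [e] using he
  · rw [card_toEntries, entryProd_toEntries, partSize]

end

/-- `π_w` is the operator attached to a reduced expression of `w`; the formula is asserted for
every reduced expression of `w = wordProd (flagWord f)`, the displayed one being among them. -/
theorem theorem4p3 {r : ℕ} (lam f : Fin r → ℕ) (h : IsFlaggedPartition lam f)
    (hf : ∀ i : Fin r, (i : ℕ) + 1 ≤ f i) :
    IsReducedExpression (flagWord f) (wordProd (flagWord f)) ∧
    ∀ ω : List ℕ, IsReducedExpression ω (wordProd (flagWord f)) →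
      flaggedGrothendieck lam f =
        dividedDiffWord ω
          (∏ i : Fin r, ∏ j ∈ Finset.Icc 1 (lam i + f i - ((i : ℕ) + 1)),
            oplus (varX ((i : ℕ) + 1)) (varB j)) := by
  have hred := isReducedExpression_flagWord f
  refine ⟨hred, fun ω hω => ?_⟩
  have hn : ∀ i, f i ≤ Finset.univ.sup f := fun i => Finset.le_sup (Finset.mem_univ i)
  have hlam : ∀ i : Fin r, rowLen lam (i + 1) ≤ lam i := by
    intro i
    rw [rowLen]
    split_ifs
    · exact h.antitone (Fin.le_def.2 (Nat.le_succ _))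
    · exact Nat.zero_le _
  rw [dividedDiffWord_eq_of_reduced hω hred, flaggedGrothendieck_eq_entrySum hn,
    entrySum_eq_chainSum hlam,
    chainSum_eq_dividedDiffWord 0 _ h.antitone h.monotone (by simpa using hf) (by simpa using hn),
    flagBlocks_zero]
  simp only [zero_add]
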